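/- For every $n\in\mathbb N$ let $X_n$ be a random Hermitian $n\times n$ matrix with complex entries and let $\sim_n$ be an equivalence relation on $[n]^2$, $[n]=\{1,\dots,n\}$, such that the random vectors $\{(X_n)_{ij}\}_{(i,j)\in C}$, with $C$ ranging over the equivalence classes of $\sim_n$, are independent (the dependence within a class is arbitrary). Assume that the entries are centered and have unit variance, $\mathbb E (X_n)_{ij}=0$ and $\mathbb E|(X_n)_{ij}|^2=1$ for all $n$ and all $i,j\in[n]$, and that * (C0) for every $k\in\mathbb N$: $\ \sup\{\mathbb E|(X_n)_{ij}|^k : 1\le i,j\le n,\ n\in\mathbb N\}<\infty$; * (C1) $\max_{i\in[n]}\#\{(j,i',j')\in[n]^3 : (i,j)\sim_n(i',j')\}=o(n^2)$; * (C2) there is $B>0$ such that for all $n$: $\ \max_{(i,j,i')\in[n]^3}\#\{j'\in[n] : (i,j)\sim_n(i',j')\}\le B$; * (C3) $\#\{(i,j,i')\in[n]^3 : (i,j)\sim_n(j,i'),\ i'\ne i\}=o(n^2)$. Let $L_n=\frac1n\sum_{k=1}^n\delta_{\lambda_k}$ be the empirical spectral distribution of $\frac1{\sqrt n}X_n$,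 where $\lambda_1\le\dots\le\lambda_n$ are its eigenvalues counted with multiplicity, and let $\sigma$ be the semicircle law, i.e. the probability measure on $\mathbb R$ with density $\frac1{2\pi}\sqrt{4-x^2}\,\mathbf 1_{\{|x|\le2\}}$. Then $L_n$ converges to $\sigma$ weakly in probability: for every metric $d$ on the set of probability measures on $\mathbb R$ that metrizes weak convergence, $d(L_n,\sigma)\to0$ in probability as $n\to\infty$. -/

import Mathlib

open MeasureTheory ProbabilityTheory Filter Topology Asymptotics
open scoped ENNReal NNReal

/-! ### The semicircle law -/

/-- The density `x ↦ (2π)⁻¹ √(4 - x²) 1_{|x| ≤ 2}`. -/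
noncomputable def semicircleDensity (x : ℝ) : ℝ :=
  Set.indicator (Set.Icc (-2) 2) (fun x => 1 / (2 * Real.pi) * √(4 - x ^ 2)) x

/-- The measure on `ℝ` with the semicircle density. -/
noncomputable def semicircleMeasure : Measure ℝ :=
  volume.withDensity (fun x => ENNReal.ofReal (semicircleDensity x))

theorem integral_sqrt_four_sub_sq : ∫ x in (-2 : ℝ)..2, √(4 - x ^ 2) = 2 * Real.pi := by
  have h : ∀ x : ℝ, √(4 - x ^ 2) = 2 * √(1 - (x / 2) ^ 2) := by
    intro x
    rw [show (4 : ℝ) - x ^ 2 = 2 ^ 2 * (1 - (x / 2) ^ 2) by ring,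
      Real.sqrt_mul (by norm_num), Real.sqrt_sq (by norm_num)]
  simp_rw [h]
  rw [intervalIntegral.integral_const_mul,
    intervalIntegral.integral_comp_div (fun y => √(1 - y ^ 2)) (two_ne_zero)]
  norm_num [integral_sqrt_one_sub_sq]
  ring

theorem isProbabilityMeasure_semicircle : IsProbabilityMeasure semicircleMeasure := by
  constructor
  have hint : IntegrableOn (fun x : ℝ => 1 / (2 * Real.pi) * √(4 - x ^ 2)) (Set.Icc (-2) 2) :=
    Continuous.integrableOn_Icc (by fun_prop)
  rw [semicircleMeasure, withDensity_apply _ MeasurableSet.univ, Measure.restrict_univ,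
    ← ofReal_integral_eq_lintegral_ofReal]
  · unfold semicircleDensity
    rw [integral_indicator measurableSet_Icc, integral_Icc_eq_integral_Ioc,
      ← intervalIntegral.integral_of_le (by norm_num), intervalIntegral.integral_const_mul,
      integral_sqrt_four_sub_sq, one_div_mul_cancel (by positivity), ENNReal.ofReal_one]
  · exact (integrable_indicator_iff measurableSet_Icc).2 hint
  · exact Eventually.of_forall fun x => Set.indicator_nonneg (fun _ _ => by positivity) x

/-- The semicircle law as a probability measure on `ℝ`. -/
noncomputable def semicircleLaw : ProbabilityMeasure ℝ :=
  ⟨semicircleMeasure, isProbabilityMeasure_semicircle⟩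

/-! ### Empirical spectral distribution -/

/-- The measure `(1/n) ∑ δ_{λ_i}`, the `λ_i` being the eigenvalues of the Hermitian matrix `A`
listed with multiplicity. -/
noncomputable def esdMeasure {n : ℕ} {A : Matrix (Fin n) (Fin n) ℂ} (hA : A.IsHermitian) :
    Measure ℝ :=
  (n : ℝ≥0∞)⁻¹ • ∑ i : Fin n, Measure.dirac (hA.eigenvalues i)

theorem isProbabilityMeasure_esdMeasure {n : ℕ} (hn : n ≠ 0) {A : Matrix (Fin n) (Fin n) ℂ}
    (hA : A.IsHermitian) : IsProbabilityMeasure (esdMeasure hA) := by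
  constructor
  simp [esdMeasure, ENNReal.inv_mul_cancel, hn]

/-- The empirical spectral distribution of a Hermitian matrix, as a probability measure.
The `0 × 0` matrix has no eigenvalues; it is given the value `δ_0` by convention. -/
noncomputable def esd {n : ℕ} {A : Matrix (Fin n) (Fin n) ℂ} (hA : A.IsHermitian) :
    ProbabilityMeasure ℝ :=
  if hn : n = 0 then ⟨Measure.dirac 0, inferInstance⟩
  else ⟨esdMeasure hA, isProbabilityMeasure_esdMeasure hn hA⟩

/-- The normalization `X / √n` of an `n × n` matrix. -/
noncomputable def normalized {n : ℕ} (A : Matrix (Fin n) (Fin n) ℂ) : Matrix (Fin n) (Fin n) ℂ :=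
  (1 / √(n : ℝ)) • A

theorem normalized_isHermitian {n : ℕ} {A : Matrix (Fin n) (Fin n) ℂ} (hA : A.IsHermitian) :
    (normalized A).IsHermitian := by
  unfold normalized Matrix.IsHermitian
  rw [Matrix.conjTranspose_smul, hA.eq, star_trivial]

/-! ### Weak convergence in probability -/

/-- `d` is a metric on the probability measures on `ℝ` which metrizes weak convergence
(convergence in `ProbabilityMeasure ℝ` is convergence of the integrals of all bounded continuous
functions). -/
structure MetrizesWeakConvergence
    (d : ProbabilityMeasure ℝ → ProbabilityMeasure ℝ → ℝ) : Prop where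
  eq_zero_iff : ∀ ν ρ, d ν ρ = 0 ↔ ν = ρ
  symm : ∀ ν ρ, d ν ρ = d ρ ν
  triangle : ∀ ν ρ τ, d ν τ ≤ d ν ρ + d ρ τ
  tendsto_iff : ∀ (ν : ℕ → ProbabilityMeasure ℝ) (ρ : ProbabilityMeasure ℝ),
    Tendsto ν atTop (𝓝 ρ) ↔ Tendsto (fun k => d (ν k) ρ) atTop (𝓝 0)

/-- The random probability measures `L n`, defined on the probability spaces `(Ω n, P n)`,
converge weakly in probability to `ρ`: for every metric `d` that metrizes weak convergence,
`d (L n) ρ → 0` in probability. -/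
def WeaklyConvergesInProbability {Ω : ℕ → Type*} [∀ n, MeasurableSpace (Ω n)]
    (P : ∀ n, Measure (Ω n)) (L : ∀ n, Ω n → ProbabilityMeasure ℝ)
    (ρ : ProbabilityMeasure ℝ) : Prop :=
  ∀ d : ProbabilityMeasure ℝ → ProbabilityMeasure ℝ → ℝ, MetrizesWeakConvergence d →
    ∀ ε : ℝ, 0 < ε → Tendsto (fun n => P n {ω | ε < d (L n ω) ρ}) atTop (𝓝 0)

/-! ### The dependence structure and the conditions (C0)-(C3) -/

/-- The random vectors formed by the entries of `X` whose positions lie in the same class of `r`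
are (mutually) independent for distinct classes. -/
def IndependentClasses {n : ℕ} {Ω : Type*} [MeasurableSpace Ω] (P : Measure Ω)
    (X : Ω → Matrix (Fin n) (Fin n) ℂ) (r : Setoid (Fin n × Fin n)) : Prop :=
  iIndepFun (fun (c : Quotient r) (ω : Ω) (p : {p : Fin n × Fin n // Quotient.mk r p = c}) =>
    X ω p.1.1 p.1.2) P

/-- (C0): for each `k`, the `k`-th absolute moments of all the entries are uniformly bounded. -/
def CondC0 {Ω : ℕ → Type*} [∀ n, MeasurableSpace (Ω n)] (P : ∀ n, Measure (Ω n))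
    (X : ∀ n, Ω n → Matrix (Fin n) (Fin n) ℂ) : Prop :=
  ∀ k : ℕ, ∃ C : ℝ≥0, ∀ (n : ℕ) (i j : Fin n), ∫⁻ ω, ‖X n ω i j‖ₑ ^ k ∂(P n) ≤ C

/-- (C1): `max_i #{(j, i', j') : (i, j) ∼ₙ (i', j')} = o(n²)`. -/
def CondC1 (r : ∀ n : ℕ, Setoid (Fin n × Fin n)) : Prop :=
  (fun n : ℕ => ((Finset.univ.sup fun i : Fin n =>
      {t : Fin n × Fin n × Fin n | (r n) (i, t.1) (t.2.1, t.2.2)}.ncard : ℕ) : ℝ))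
    =o[atTop] (fun n : ℕ => (n : ℝ) ^ 2)

/-- (C2): `max_{i, j, i'} #{j' : (i, j) ∼ₙ (i', j')} ≤ B` with `B` independent of `n`. -/
def CondC2 (r : ∀ n : ℕ, Setoid (Fin n × Fin n)) : Prop :=
  ∃ B : ℝ, 0 < B ∧ ∀ (n : ℕ) (i j i' : Fin n),
    ({j' : Fin n | (r n) (i, j) (i', j')}.ncard : ℝ) ≤ B

/-- (C3): `#{(i, j, i') : (i, j) ∼ₙ (j, i'), i' ≠ i} = o(n²)`. -/
def CondC3 (r : ∀ n : ℕ, Setoid (Fin n × Fin n)) : Prop :=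
  (fun n : ℕ => ({t : Fin n × Fin n × Fin n |
      (r n) (t.1, t.2.1) (t.2.1, t.2.2) ∧ t.2.2 ≠ t.1}.ncard : ℝ))
    =o[atTop] (fun n : ℕ => (n : ℝ) ^ 2)

/-! ### Counting maps by exploring their domain -/

/-! The proof is by the method of moments, with the Catalan numbers entering through their recursion
rather than through a count of noncrossing pairings. The trace of the `k`-th power is a sum over
closed paths with `k` steps, and the expectation of a path vanishes as soon as some class is met by
exactly one step.

Paths with a prescribed pattern of classes are counted by exploring vertices along steps
(`restrictionCard_mul_le`): a step in a new class costs a factor `n`, while by (C2) a step in a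
class already seen costs only a constant. A pattern with `m` classes therefore carries `O(n ^ (m +
1))` paths. Compared with the scale `n ^ (k / 2 + 1)`, patterns with fewer than `k / 2` classes are
negligible. When the steps are paired and some pair is not a step and its reversal, there is a
crossing or two paired steps `(i, j)`, `(j, i')` with `i' ≠ i` (`exists_crossing_or_cherry`); (C1)
makes the first case negligible and (C3) the second.

For the remaining paths, removing the first step and the step that reverses it cuts the path into
two closed paths. This gives `E tr X ^ (k + 2) ≈ ∑ E [tr X ^ i * tr X ^ (k - i)]`
(`norm_integral_trace_pow_sub_le`). Covariances of traces count pairs of paths sharing a class and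
are of lower order (`card_linkedLoops_le`), so the limits of the normalized expected traces satisfy
the Catalan recursion (`tendsto_expected_moment`). The same covariance bound gives convergence of
each moment in mean square. Finally, closeness of finitely many moments forces closeness in any
metric of weak convergence (`MetrizesWeakConvergence.exists_moments_near`), and Chebyshev's
inequality concludes. -/

theorem Finset.card_image_le_card_image_of_imp {α β γ : Type*} [DecidableEq β] [DecidableEq γ]
    {S : Finset α} {f : α → β} {g : α → γ}
    (h : ∀ p ∈ S, ∀ q ∈ S, g p = g q → f p = f q) : (S.image f).card ≤ (S.image g).card := by
  classical
  rcases S.eq_empty_or_nonempty with rfl | ⟨p₀, -⟩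
  · simp
  have : Nonempty α := ⟨p₀⟩
  have key : ∀ y ∈ S.image f, ∃ p ∈ S, f p = y := fun y hy => Finset.mem_image.1 hy
  choose! c hc hfc using key
  refine Finset.card_le_card_of_injOn (fun y => g (c y))
    (fun y hy => Finset.mem_image_of_mem g (hc y hy)) ?_
  intro y hy z hz hyz
  rw [← hfc y hy, ← hfc z hz]
  exact h _ (hc y hy) _ (hc z hz) hyz

section Exploration

open scoped Classical in
/-- The values of `p` on `W`, forgetting the values elsewhere. -/
noncomputable def mask {V α : Type*} (W : Finset V) (p : V → α) : V → Option α :=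
  fun v => if v ∈ W then some (p v) else none

theorem mask_eq_mask_iff {V α : Type*} {W : Finset V} {p q : V → α} :
    mask W p = mask W q ↔ ∀ w ∈ W, p w = q w := by
  constructor
  · intro h w hw
    have := congrFun h w
    simpa [mask, hw] using this
  · intro h
    funext v
    by_cases hv : v ∈ W
    · simp [mask, hv, h v hv]
    · simp [mask, hv]

open scoped Classical in
/-- The number of different restrictions to `W` of the maps in `S`. -/
noncomputable def restrictionCard {V α : Type*} (S : Finset (V → α)) (W : Finset V) : ℕ :=
  (S.image (mask W)).card

theorem restrictionCard_univ {V α : Type*} [Fintype V] (S : Finset (V → α)) :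
    restrictionCard S Finset.univ = S.card := by
  classical
  have hinj : Function.Injective (mask (Finset.univ : Finset V) (α := α)) := fun p q h =>
    funext fun v => mask_eq_mask_iff.1 h v (Finset.mem_univ v)
  rw [restrictionCard]
  convert Finset.card_image_of_injective S hinj

/-- If the values on `W` are determined by `g`, there are at most as many restrictions to `W` as
values of `g`. -/
theorem restrictionCard_le_of_determined {V α β : Type*} {S : Finset (V → α)} {W : Finset V}
    (g : (V → α) → β) (T : Finset β) (hT : ∀ p ∈ S, g p ∈ T)
    (hg : ∀ p ∈ S, ∀ q ∈ S, g p = g q → ∀ w ∈ W, p w = q w) : restrictionCard S W ≤ T.card := by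
  classical
  refine (Finset.card_image_le_card_image_of_imp (g := g)
    fun p hp q hq h => mask_eq_mask_iff.2 (hg p hp q hq h)).trans (Finset.card_le_card ?_)
  exact Finset.image_subset_iff.2 hT

/-- Forgetting the value at `v` maps the restrictions to `insert v W` onto those to `W`. A point of
a fibre is determined by its value at `v`, which lies in `T f` for any representative `f` of the
fibre. -/
theorem restrictionCard_insert_le {V α : Type*} [DecidableEq V] [DecidableEq α]
    {S : Finset (V → α)} {W : Finset V} {v : V} {c : ℕ}
    (T : (V → α) → Finset α) (hT : ∀ f ∈ S, (T f).card ≤ c)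
    (hmem : ∀ f ∈ S, ∀ g ∈ S, (∀ w ∈ W, g w = f w) → g v ∈ T f) :
    restrictionCard S (insert v W) ≤ restrictionCard S W * c := by
  classical
  let forget : (V → Option α) → (V → Option α) := fun m w => if w ∈ W then m w else none
  have hforget : ∀ p : V → α, forget (mask (insert v W) p) = mask W p := by
    intro p
    funext w
    by_cases hw : w ∈ W <;> simp [forget, mask, hw]
  have himage : (S.image (mask (insert v W))).image forget = S.image (mask W) := by
    rw [Finset.image_image]
    exact Finset.image_congr fun p _ => hforget p
  have := Finset.card_le_mul_card_image (f := forget) (S.image (mask (insert v W))) c ?_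
  · rw [himage] at this
    rw [mul_comm]
    exact this
  intro m hm
  rw [himage] at hm
  obtain ⟨f, hf, rfl⟩ := Finset.mem_image.1 hm
  refine le_trans ?_ (hT f hf)
  refine (Finset.card_le_card_of_injOn (t := (T f).image some) (fun m => m v) ?_ ?_).trans
    Finset.card_image_le
  · intro m' hm'
    obtain ⟨hm1, hm2⟩ := Finset.mem_filter.1 hm'
    obtain ⟨g, hg, rfl⟩ := Finset.mem_image.1 hm1
    rw [hforget, mask_eq_mask_iff] at hm2
    simpa [mask] using hmem f hf g hg hm2
  · intro m1 hm1 m2 hm2 h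
    obtain ⟨h1, h1'⟩ := Finset.mem_filter.1 hm1
    obtain ⟨h2, h2'⟩ := Finset.mem_filter.1 hm2
    obtain ⟨g1, hg1, rfl⟩ := Finset.mem_image.1 h1
    obtain ⟨g2, hg2, rfl⟩ := Finset.mem_image.1 h2
    rw [hforget] at h1' h2'
    have h12 := mask_eq_mask_iff.1 (h1'.trans h2'.symm)
    refine mask_eq_mask_iff.2 fun w hw => ?_
    rcases Finset.mem_insert.1 hw with rfl | hw
    · simpa [mask] using h
    · exact h12 w hw

theorem restrictionCard_insert_le_mul_card {V α : Type*} [DecidableEq V] [Fintype α]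
    (S : Finset (V → α)) (W : Finset V) (v : V) :
    restrictionCard S (insert v W) ≤ restrictionCard S W * Fintype.card α := by
  classical
  exact restrictionCard_insert_le (fun _ => Finset.univ) (fun _ _ => le_rfl)
    (fun _ _ _ _ _ => Finset.mem_univ _)

theorem restrictionCard_empty_le {V α : Type*} (S : Finset (V → α)) :
    restrictionCard S ∅ ≤ 1 := by
  classical
  simpa using restrictionCard_le_of_determined (S := S) (W := ∅) (fun _ => ()) {()}
    (by simp) (by simp)

variable {n : ℕ} {V E ι : Type*}

/-- The pair of values of `p` at the ends of the edge `e`. -/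
def stepOf (src tgt : E → V) (p : V → Fin n) (e : E) : Fin n × Fin n := (p (src e), p (tgt e))

open scoped Classical in
/-- The labels of the edges in `F` with both ends in `W`. -/
noncomputable def labelsIn (src tgt : E → V) (κ : E → ι) (F : Finset E) (W : Finset V) :
    Finset ι :=
  (F.filter fun e => src e ∈ W ∧ tgt e ∈ W).image κ

theorem mem_labelsIn {src tgt : E → V} {κ : E → ι} {F : Finset E} {W : Finset V} {x : ι} :
    x ∈ labelsIn src tgt κ F W ↔ ∃ e ∈ F, src e ∈ W ∧ tgt e ∈ W ∧ κ e = x := by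
  simp [labelsIn, and_assoc]

theorem labelsIn_mono {src tgt : E → V} {κ : E → ι} {F : Finset E} {W W' : Finset V}
    (h : W ⊆ W') : labelsIn src tgt κ F W ⊆ labelsIn src tgt κ F W' := by
  intro x hx
  rw [mem_labelsIn] at hx ⊢
  obtain ⟨e, he, h1, h2, h3⟩ := hx
  exact ⟨e, he, h h1, h h2, h3⟩

/-- The relation is invariant under exchanging the two coordinates, and a class has at most `B`
elements in each row. -/
structure RowBounded (r : Setoid (Fin n × Fin n)) (B : ℕ) : Prop where
  one_le : 1 ≤ B
  swap : ∀ i j, r (i, j) (j, i)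
  row : ∀ i j i', ((Set.toFinite {j' : Fin n | r (i, j) (i', j')}).toFinset).card ≤ B

/-- One step of the exploration. If the label of `e` already occurs inside `W`, the class of `e` is
known and `v` has at most `B` values; otherwise `v` is free, but the number of labels grows by one.
Powers of `n` are kept on both sides to avoid division. -/
theorem restrictionCard_insert_mul_le [DecidableEq V] {r : Setoid (Fin n × Fin n)} {B : ℕ}
    (hr : RowBounded r B) {src tgt : E → V} {κ : E → ι} {S : Finset (V → Fin n)}
    (hS : ∀ p ∈ S, ∀ a b, κ a = κ b → r (stepOf src tgt p a) (stepOf src tgt p b))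
    {F : Finset E} {W : Finset V} {e : E} (he : e ∈ F) {w v : V} (hw : w ∈ W)
    (hends : src e = w ∧ tgt e = v ∨ tgt e = w ∧ src e = v) :
    restrictionCard S (insert v W) * n ^ (labelsIn src tgt κ F W).card ≤
      restrictionCard S W * n ^ (labelsIn src tgt κ F (insert v W)).card * B := by
  classical
  rcases Nat.eq_zero_or_pos n with rfl | hn
  · have : S = ∅ := by
      ext p
      exact (p v).elim0
    simp [this, restrictionCard]
  by_cases hold : κ e ∈ labelsIn src tgt κ F W
  · obtain ⟨e', he', h1, h2, h3⟩ := mem_labelsIn.1 hold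
    have hle : restrictionCard S (insert v W) ≤ restrictionCard S W * B := by
      refine restrictionCard_insert_le
        (fun f => (Set.toFinite {j' : Fin n | r (stepOf src tgt f e') (f w, j')}).toFinset)
        (fun f _ => hr.row _ _ _) ?_
      intro f hf g hg hfg
      have hstep : stepOf src tgt g e' = stepOf src tgt f e' := by
        simp [stepOf, hfg _ h1, hfg _ h2]
      have := hS g hg e' e h3
      rw [hstep] at this
      simp only [Set.Finite.mem_toFinset, Set.mem_ofPred_eq]
      rw [← hfg w hw]
      rcases hends with ⟨ha, hb⟩ | ⟨ha, hb⟩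
      · simpa [stepOf, ha, hb] using this
      -- Here `e` is traversed against its orientation, so the two coordinates must be exchanged to
      -- land in the row of `w`.
      · refine r.trans this ?_
        simpa [stepOf, ha, hb] using hr.swap (g v) (g w)
    calc _ ≤ restrictionCard S W * B * n ^ (labelsIn src tgt κ F (insert v W)).card :=
          Nat.mul_le_mul hle (Nat.pow_le_pow_right hn
            (Finset.card_le_card (labelsIn_mono (Finset.subset_insert _ _))))
      _ = _ := by ring
  · have hnew : (labelsIn src tgt κ F W).card + 1 ≤ (labelsIn src tgt κ F (insert v W)).card := by
      rw [← Finset.card_insert_of_notMem hold]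
      refine Finset.card_le_card (Finset.insert_subset ?_
        (labelsIn_mono (Finset.subset_insert _ _)))
      refine mem_labelsIn.2 ⟨e, he, ?_, ?_, rfl⟩ <;>
        rcases hends with ⟨ha, hb⟩ | ⟨ha, hb⟩ <;> simp [ha, hb, hw]
    have hle := restrictionCard_insert_le_mul_card S W v
    rw [Fintype.card_fin] at hle
    calc _ ≤ restrictionCard S W * n * n ^ (labelsIn src tgt κ F W).card := by gcongr
      _ = restrictionCard S W * n ^ ((labelsIn src tgt κ F W).card + 1) * 1 := by ring
      _ ≤ _ := by
        gcongr
        exact hr.one_le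

/-- Exploring `W₁` from `W₀` along the edges in `F`: a factor `n` is needed for each new label, and
a factor `B` for each vertex. -/
theorem restrictionCard_mul_le [DecidableEq V] {r : Setoid (Fin n × Fin n)} {B : ℕ}
    (hr : RowBounded r B) {src tgt : E → V} {κ : E → ι} {S : Finset (V → Fin n)}
    (hS : ∀ p ∈ S, ∀ a b, κ a = κ b → r (stepOf src tgt p a) (stepOf src tgt p b))
    (F : Finset E) (W₁ : Finset V) {W₀ : Finset V} (hW : W₀ ⊆ W₁)
    (hconn : ∀ W, W₀ ⊆ W → W ⊂ W₁ → ∃ e ∈ F, ∃ w ∈ W, ∃ v ∈ W₁, v ∉ W ∧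
      (src e = w ∧ tgt e = v ∨ tgt e = w ∧ src e = v)) :
    restrictionCard S W₁ * n ^ (labelsIn src tgt κ F W₀).card ≤
      restrictionCard S W₀ * n ^ (labelsIn src tgt κ F W₁).card * B ^ (W₁ \ W₀).card := by
  classical
  rcases Nat.eq_zero_or_pos n with rfl | hn
  · by_cases hV : Nonempty V
    · have : S = ∅ := by
        ext p
        exact (p hV.some).elim0
      simp [this, restrictionCard]
    · rw [not_nonempty_iff] at hV
      have : W₁ = W₀ := Subsingleton.elim _ _
      subst this
      simp
  induction h : (W₁ \ W₀).card generalizing W₀ with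
  | zero =>
    have : W₁ = W₀ := by
      apply subset_antisymm _ hW
      rw [← Finset.sdiff_eq_empty_iff_subset, ← Finset.card_eq_zero, h]
    subst this
    simp
  | succ m ih =>
    have hss : W₀ ⊂ W₁ := by
      refine Finset.ssubset_iff_subset_ne.2 ⟨hW, ?_⟩
      rintro rfl
      simp at h
    obtain ⟨e, he, w, hw, v, hv1, hv, hends⟩ := hconn W₀ subset_rfl hss
    have hsub : insert v W₀ ⊆ W₁ := Finset.insert_subset hv1 hW
    have h1 := restrictionCard_insert_mul_le hr hS he hw hends
    have h2 := ih hsub (fun W h h' => hconn W ((Finset.subset_insert _ _).trans h) h') (by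
      rw [Finset.sdiff_insert, Finset.card_erase_of_mem (by simp [hv, hv1]), h]
      rfl)
    set c0 := (labelsIn src tgt κ F W₀).card
    set c' := (labelsIn src tgt κ F (insert v W₀)).card
    set c1 := (labelsIn src tgt κ F W₁).card
    -- The power belonging to the intermediate set occurs on both sides and cancels since `n > 0`.
    refine Nat.le_of_mul_le_mul_right (c := n ^ c') ?_ (by positivity)
    calc _ = (restrictionCard S W₁ * n ^ c') * n ^ c0 := by ring
      _ ≤ (restrictionCard S (insert v W₀) * n ^ c1 * B ^ m) * n ^ c0 := by gcongr
      _ = (restrictionCard S (insert v W₀) * n ^ c0) * (n ^ c1 * B ^ m) := by ring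
      _ ≤ (restrictionCard S W₀ * n ^ c' * B) * (n ^ c1 * B ^ m) := by gcongr
      _ = _ := by ring

end Exploration

/-! ### Counting paths -/

theorem Finset.two_mul_card_image_le {α β : Type*} [DecidableEq β] {s : Finset α} {f : α → β}
    (h : ∀ a ∈ s, ∃ b ∈ s, b ≠ a ∧ f b = f a) : 2 * (s.image f).card ≤ s.card := by
  classical
  rw [Finset.card_eq_sum_card_image f s, mul_comm, ← smul_eq_mul, ← Finset.sum_const]
  refine Finset.sum_le_sum fun x hx => ?_
  obtain ⟨a, ha, rfl⟩ := Finset.mem_image.1 hx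
  obtain ⟨b, hb, hba, hfb⟩ := h a ha
  exact Finset.one_lt_card.2 ⟨a, by simp [ha], b, by simp [hb, hfb], hba.symm⟩

theorem Finset.two_mul_card_image_lt {α β : Type*} [DecidableEq β] {s : Finset α} {f : α → β}
    (h : ∀ a ∈ s, ∃ b ∈ s, b ≠ a ∧ f b = f a) {x y z : α} (hx : x ∈ s) (hy : y ∈ s) (hz : z ∈ s)
    (hxy : x ≠ y) (hxz : x ≠ z) (hyz : y ≠ z) (hfy : f y = f x) (hfz : f z = f x) :
    2 * (s.image f).card < s.card := by
  classical
  rw [Finset.card_eq_sum_card_image f s, mul_comm, ← smul_eq_mul, ← Finset.sum_const]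
  refine Finset.sum_lt_sum (fun w hw => ?_) ⟨f x, Finset.mem_image_of_mem f hx, ?_⟩
  · obtain ⟨a, ha, rfl⟩ := Finset.mem_image.1 hw
    obtain ⟨b, hb, hba, hfb⟩ := h a ha
    exact Finset.one_lt_card.2 ⟨a, by simp [ha], b, by simp [hb, hfb], hba.symm⟩
  · exact Finset.two_lt_card.2
      ⟨x, by simp [hx], y, by simp [hy, hfy], z, by simp [hz, hfz], hxy, hxz, hyz⟩

section Pattern

variable {n : ℕ} {E : Type*} [Fintype E]

open scoped Classical in
/-- The map sending an index `a` to the set of indices whose position is equivalent to that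
of `a`. -/
noncomputable def classPattern (r : Setoid (Fin n × Fin n)) (q : E → Fin n × Fin n) :
    E → Finset E :=
  fun a => Finset.univ.filter fun b => r (q a) (q b)

theorem classPattern_eq_iff {r : Setoid (Fin n × Fin n)} {q : E → Fin n × Fin n} {a b : E} :
    classPattern r q a = classPattern r q b ↔ r (q a) (q b) := by
  constructor
  · intro h
    have : b ∈ classPattern r q b := by simp [classPattern]
    rw [← h] at this
    simpa [classPattern] using this
  · intro h
    ext c
    simp only [classPattern, Finset.mem_filter, Finset.mem_univ, true_and]
    exact ⟨fun h' => r.trans (r.symm h) h', fun h' => r.trans h h'⟩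

open scoped Classical in
/-- The number of classes met by the positions `q a`. -/
noncomputable def numClasses (r : Setoid (Fin n × Fin n)) (q : E → Fin n × Fin n) : ℕ :=
  (Finset.univ.image (classPattern r q)).card

theorem numClasses_eq_card [DecidableEq (Finset E)] (r : Setoid (Fin n × Fin n))
    (q : E → Fin n × Fin n) : numClasses r q = (Finset.univ.image (classPattern r q)).card := by
  rw [numClasses]
  congr!

/-- No class is met exactly once by the positions `q a`. -/
def NoSingleClass (r : Setoid (Fin n × Fin n)) (q : E → Fin n × Fin n) : Prop :=
  ∀ a, ∃ b, b ≠ a ∧ r (q b) (q a)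

theorem NoSingleClass.two_mul_numClasses_le {r : Setoid (Fin n × Fin n)} {q : E → Fin n × Fin n}
    (h : NoSingleClass r q) : 2 * numClasses r q ≤ Fintype.card E := by
  classical
  refine Finset.two_mul_card_image_le fun a _ => ?_
  obtain ⟨b, hb, hr⟩ := h a
  exact ⟨b, Finset.mem_univ _, hb, classPattern_eq_iff.2 hr⟩

/-- Every class is met at least twice, so a class met three times makes the bound strict.
Consequently, equality forces the classes to be pairs. -/
theorem NoSingleClass.two_mul_numClasses_lt {r : Setoid (Fin n × Fin n)} {q : E → Fin n × Fin n}
    (h : NoSingleClass r q) {x y z : E} (hxy : x ≠ y) (hxz : x ≠ z) (hyz : y ≠ z)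
    (hy : r (q y) (q x)) (hz : r (q z) (q x)) : 2 * numClasses r q < Fintype.card E := by
  classical
  refine Finset.two_mul_card_image_lt (fun a _ => ?_) (Finset.mem_univ x) (Finset.mem_univ y)
    (Finset.mem_univ z) hxy hxz hyz (classPattern_eq_iff.2 hy) (classPattern_eq_iff.2 hz)
  obtain ⟨b, hb, hr⟩ := h a
  exact ⟨b, Finset.mem_univ _, hb, classPattern_eq_iff.2 hr⟩

end Pattern

/-- A discrete intermediate value argument. The location of the step is recorded so that
explorations can avoid forbidden steps. -/
theorem Fin.exists_step_leaving {K : ℕ} {W : Finset (Fin (K + 1))} {x : Fin (K + 1)} (hx : x ∈ W)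
    (v : Fin (K + 1)) (hv : v ∉ W) (hxv : x < v) :
    ∃ e : Fin K, x ≤ e.castSucc ∧ e.succ ≤ v ∧ e.castSucc ∈ W ∧ e.succ ∉ W := by
  induction v using Fin.induction with
  | zero => exact absurd hxv (Fin.not_lt_zero x)
  | succ i ih =>
    have hle : x ≤ i.castSucc := Fin.le_castSucc_iff.2 hxv
    by_cases hi : i.castSucc ∈ W
    · exact ⟨i, hle, le_rfl, hi, hv⟩
    · obtain ⟨e, h1, h2, h3, h4⟩ := ih hi (lt_of_le_of_ne hle (by rintro rfl; exact hi hx))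
      exact ⟨e, h1, h2.trans (Fin.castSucc_lt_succ (i := i)).le, h3, h4⟩

theorem Fin.exists_step_entering {K : ℕ} {W : Finset (Fin (K + 1))} {v : Fin (K + 1)} (hv : v ∉ W)
    (y : Fin (K + 1)) (hy : y ∈ W) (hvy : v < y) :
    ∃ e : Fin K, v ≤ e.castSucc ∧ e.succ ≤ y ∧ e.castSucc ∉ W ∧ e.succ ∈ W := by
  induction y using Fin.induction with
  | zero => exact absurd hvy (Fin.not_lt_zero v)
  | succ i ih =>
    have hle : v ≤ i.castSucc := Fin.le_castSucc_iff.2 hvy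
    by_cases hi : i.castSucc ∈ W
    · obtain ⟨e, h1, h2, h3, h4⟩ := ih hi (lt_of_le_of_ne hle (by rintro rfl; exact hv hi))
      exact ⟨e, h1, h2.trans (Fin.castSucc_lt_succ (i := i)).le, h3, h4⟩
    · exact ⟨i, hle, le_rfl, hi, hy⟩

/-! ### Counting paths with a prescribed pattern of classes -/

section Paths

variable {n K : ℕ} {r : Setoid (Fin n × Fin n)} {B : ℕ}

/-- The steps of a path. -/
def pathStep (p : Fin (K + 1) → Fin n) : Fin K → Fin n × Fin n :=
  stepOf Fin.castSucc Fin.succ p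

theorem pathStep_apply (p : Fin (K + 1) → Fin n) (e : Fin K) :
    pathStep p e = (p e.castSucc, p e.succ) := rfl

/-- A path is connected, so it can be explored from any nonempty `W`; labels already present inside
`W` are not paid for again. -/
theorem path_card_mul_le (hr : RowBounded r B) {ι : Type*} [DecidableEq ι] {κ : Fin K → ι}
    {S : Finset (Fin (K + 1) → Fin n)}
    (hS : ∀ p ∈ S, ∀ a b, κ a = κ b → r (pathStep p a) (pathStep p b))
    {W : Finset (Fin (K + 1))} (hW : W.Nonempty) :
    S.card * n ^ (labelsIn Fin.castSucc Fin.succ κ Finset.univ W).card ≤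
      restrictionCard S W * n ^ (Finset.univ.image κ).card * B ^ (K + 1) := by
  classical
  have h := restrictionCard_mul_le hr hS Finset.univ Finset.univ (Finset.subset_univ W) ?_
  · rw [restrictionCard_univ] at h
    have h1 : labelsIn Fin.castSucc Fin.succ κ Finset.univ Finset.univ = Finset.univ.image κ := by
      ext x
      simp [mem_labelsIn]
    rw [h1] at h
    refine h.trans ?_
    gcongr
    · exact hr.one_le
    · exact (Finset.card_le_univ _).trans (by simp)
  · intro W' hW' hlt
    obtain ⟨w, hw⟩ := hW
    obtain ⟨v, -, hv⟩ := Finset.exists_of_ssubset hlt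
    have hw' := hW' hw
    rcases lt_trichotomy w v with h | rfl | h
    · obtain ⟨e, -, -, h1, h2⟩ := Fin.exists_step_leaving hw' v hv h
      exact ⟨e, Finset.mem_univ _, _, h1, _, Finset.mem_univ _, h2, Or.inl ⟨rfl, rfl⟩⟩
    · exact absurd hw' hv
    · obtain ⟨e, -, -, h1, h2⟩ := Fin.exists_step_entering hv w hw' h
      exact ⟨e, Finset.mem_univ _, _, h2, _, Finset.mem_univ _, h1, Or.inr ⟨rfl, rfl⟩⟩

theorem path_card_le (hr : RowBounded r B) {ι : Type*} [DecidableEq ι] {κ : Fin K → ι}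
    {S : Finset (Fin (K + 1) → Fin n)}
    (hS : ∀ p ∈ S, ∀ a b, κ a = κ b → r (pathStep p a) (pathStep p b)) :
    S.card ≤ n * n ^ (Finset.univ.image κ).card * B ^ (K + 1) := by
  classical
  rcases Nat.eq_zero_or_pos n with rfl | hn
  · have : S = ∅ := by
      ext p
      exact (p 0).elim0
    simp [this]
  have h := path_card_mul_le hr hS (Finset.singleton_nonempty 0)
  have h0 : restrictionCard S {0} ≤ n := by
    have := restrictionCard_insert_le_mul_card S ∅ 0
    rw [Fintype.card_fin] at this
    exact this.trans ((Nat.mul_le_mul_right _ (restrictionCard_empty_le S)).trans (by simp))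
  calc S.card ≤ S.card * n ^ (labelsIn Fin.castSucc Fin.succ κ Finset.univ {0}).card :=
        Nat.le_mul_of_pos_right _ (by positivity)
    _ ≤ _ := h.trans (by gcongr)

/-- The number of `(i, j, i', j')` with `(i, j) ∼ (i', j')` and `i` fixed is at most `γ`. -/
def StarBounded (r : Setoid (Fin n × Fin n)) (γ : ℕ) : Prop :=
  ∀ i : Fin n, ((Set.toFinite {t : Fin n × Fin n × Fin n |
    r (i, t.1) (t.2.1, t.2.2)}).toFinset).card ≤ γ

/-- The number of `(i, j, i')` with `(i, j) ∼ (j, i')` and `i' ≠ i` is at most `γ`. -/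
def CherryBounded (r : Setoid (Fin n × Fin n)) (γ : ℕ) : Prop :=
  ((Set.toFinite {t : Fin n × Fin n × Fin n |
    r (t.1, t.2.1) (t.2.1, t.2.2) ∧ t.2.2 ≠ t.1}).toFinset).card ≤ γ

/-- The ends of `a` and `b` take at most `n * γ` values. The vertices between are then explored from
both sides without using the step `c`, so the labels of `a` and `c` are never paid for. Two labels
out of `m` are saved, leaving `n * γ * n ^ (m - 2)` up to constants. -/
theorem card_mul_le_of_crossing (hr : RowBounded r B) {γ : ℕ} (hγ : StarBounded r γ)
    {ι : Type*} [DecidableEq ι] {κ : Fin K → ι} {S : Finset (Fin (K + 1) → Fin n)}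
    (hS : ∀ p ∈ S, ∀ a b, κ a = κ b → r (pathStep p a) (pathStep p b))
    {a b c : Fin K} (hac : a < c) (hcb : c < b) (hab : κ a = κ b)
    (ha : ∀ e, a < e → e < b → κ e ≠ κ a)
    (hc : ∀ e, a < e → e < b → e ≠ c → κ e ≠ κ c) :
    S.card * n ≤ γ * n ^ (Finset.univ.image κ).card * B ^ (2 * (K + 1)) := by
  classical
  rcases Nat.eq_zero_or_pos n with rfl | hn
  · simp
  set W₀ : Finset (Fin (K + 1)) := {a.castSucc, a.succ, b.castSucc, b.succ} with hW₀
  set W₁ : Finset (Fin (K + 1)) := Finset.Icc a.castSucc b.succ with hW₁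
  set F : Finset (Fin K) := Finset.univ.filter fun e => a < e ∧ e < b ∧ e ≠ c with hF
  have h0 : restrictionCard S W₀ ≤ n * γ := by
    let T : Finset (Σ _ : Fin n, Fin n × Fin n × Fin n) := Finset.univ.sigma fun i =>
      (Set.toFinite {t : Fin n × Fin n × Fin n | r (i, t.1) (t.2.1, t.2.2)}).toFinset
    have hT : T.card ≤ n * γ := by
      rw [Finset.card_sigma]
      exact (Finset.sum_le_card_nsmul _ _ γ fun i _ => hγ i).trans (by simp)
    refine (restrictionCard_le_of_determined
      (fun p => ⟨p a.castSucc, p a.succ, p b.castSucc, p b.succ⟩) T ?_ ?_).trans hT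
    · intro p hp
      simpa [T, pathStep_apply] using hS p hp a b hab
    · intro p _ q _ h w hw
      simp only [Sigma.mk.injEq, heq_eq_eq, Prod.mk.injEq] at h
      obtain ⟨h1, h2, h3, h4⟩ := h
      simp only [hW₀, Finset.mem_insert, Finset.mem_singleton] at hw
      rcases hw with rfl | rfl | rfl | rfl <;> assumption
  have hsub : W₀ ⊆ W₁ := by
    intro w hw
    simp only [hW₀, Finset.mem_insert, Finset.mem_singleton] at hw
    rw [hW₁, Finset.mem_Icc]
    simp only [Fin.le_def, Fin.lt_def] at *
    rcases hw with rfl | rfl | rfl | rfl <;> simp <;> omega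
  have h1 := restrictionCard_mul_le hr hS F W₁ hsub ?_
  -- The two saved labels: once the whole interval is known, so are the classes of `a` and `c`,
  -- neither of which labels a step of `F`.
  · have hlab : (labelsIn Fin.castSucc Fin.succ κ F W₁).card + 2 ≤
        (labelsIn Fin.castSucc Fin.succ κ Finset.univ W₁).card := by
      have hcF : κ c ∉ labelsIn Fin.castSucc Fin.succ κ F W₁ := by
        intro h
        obtain ⟨e, he, -, -, h⟩ := mem_labelsIn.1 h
        obtain ⟨-, he1, he2, he3⟩ := Finset.mem_filter.1 he
        exact hc e he1 he2 he3 h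
      have haF : κ a ∉ insert (κ c) (labelsIn Fin.castSucc Fin.succ κ F W₁) := by
        intro h
        rcases Finset.mem_insert.1 h with h | h
        · exact ha c hac hcb h.symm
        · obtain ⟨e, he, -, -, h⟩ := mem_labelsIn.1 h
          obtain ⟨-, he1, he2, he3⟩ := Finset.mem_filter.1 he
          exact ha e he1 he2 h
      rw [show (labelsIn Fin.castSucc Fin.succ κ F W₁).card + 2 =
        (insert (κ a) (insert (κ c) (labelsIn Fin.castSucc Fin.succ κ F W₁))).card by
          rw [Finset.card_insert_of_notMem haF, Finset.card_insert_of_notMem hcF]]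
      refine Finset.card_le_card ?_
      intro x hx
      simp only [Finset.mem_insert, mem_labelsIn] at hx
      rw [mem_labelsIn]
      rcases hx with rfl | rfl | ⟨e, -, h⟩
      · refine ⟨a, Finset.mem_univ _, ?_, ?_, rfl⟩ <;>
          simp only [hW₁, Finset.mem_Icc, Fin.le_def, Fin.lt_def] at * <;> simp <;> omega
      · refine ⟨c, Finset.mem_univ _, ?_, ?_, rfl⟩ <;>
          simp only [hW₁, Finset.mem_Icc, Fin.le_def, Fin.lt_def] at * <;> simp <;> omega
      · exact ⟨e, Finset.mem_univ _, h⟩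
    have h2 := path_card_mul_le hr hS (W := W₁) ⟨_, hsub (by simp [hW₀] : a.castSucc ∈ W₀)⟩
    set f := (labelsIn Fin.castSucc Fin.succ κ F W₁).card
    set N₁ := restrictionCard S W₁
    set m := (Finset.univ.image κ).card
    have h3 : N₁ ≤ n * γ * n ^ f * B ^ (K + 1) := by
      calc N₁ ≤ N₁ * n ^ (labelsIn Fin.castSucc Fin.succ κ F W₀).card :=
            Nat.le_mul_of_pos_right _ (by positivity)
        _ ≤ _ := h1
        _ ≤ _ := by
          gcongr
          · exact hr.one_le
          · exact (Finset.card_le_univ _).trans (by simp)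
    refine Nat.le_of_mul_le_mul_right (c := n ^ (f + 1)) ?_ (by positivity)
    calc S.card * n * n ^ (f + 1) = S.card * n ^ (f + 2) := by ring
      _ ≤ S.card * n ^ (labelsIn Fin.castSucc Fin.succ κ Finset.univ W₁).card := by
        gcongr
      _ ≤ N₁ * n ^ m * B ^ (K + 1) := h2
      _ ≤ (n * γ * n ^ f * B ^ (K + 1)) * n ^ m * B ^ (K + 1) := by gcongr
      _ = _ := by ring
  · intro W hW hlt
    obtain ⟨v, hv1, hv⟩ := Finset.exists_of_ssubset hlt
    have hW1 : ∀ w ∈ W, w ∈ W₁ := fun w hw => hlt.1 hw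
    have e1 := hW (by simp [hW₀] : a.castSucc ∈ W₀)
    have e2 := hW (by simp [hW₀] : a.succ ∈ W₀)
    have e3 := hW (by simp [hW₀] : b.castSucc ∈ W₀)
    have e4 := hW (by simp [hW₀] : b.succ ∈ W₀)
    rw [hW₁, Finset.mem_Icc] at hv1
    have n1 : v ≠ a.castSucc := by rintro rfl; exact hv e1
    have n4 : v ≠ b.succ := by rintro rfl; exact hv e4
    -- Removing `c` splits the interval into two arcs: the left one is reached forwards from the end
    -- of `a`, the right one backwards from the start of `b`.
    rcases le_or_gt v c.castSucc with hvc | hvc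
    · obtain ⟨e, f1, f2, f3, f4⟩ := Fin.exists_step_leaving e2 v hv (by
        have : v ≠ a.succ := by rintro rfl; exact hv e2
        simp only [Fin.lt_def, Fin.le_def, ne_eq, Fin.ext_iff, Fin.val_castSucc,
          Fin.val_succ] at *
        omega)
      refine ⟨e, ?_, _, f3, _, ?_, f4, Or.inl ⟨rfl, rfl⟩⟩
      · rw [hF, Finset.mem_filter]
        simp only [Fin.lt_def, Fin.le_def, ne_eq, Fin.ext_iff, Fin.val_castSucc,
          Fin.val_succ, Finset.mem_univ, true_and] at *
        omega
      · rw [hW₁, Finset.mem_Icc]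
        simp only [Fin.lt_def, Fin.le_def, ne_eq, Fin.ext_iff, Fin.val_castSucc,
          Fin.val_succ] at *
        omega
    · obtain ⟨e, f1, f2, f3, f4⟩ := Fin.exists_step_entering hv _ e3 (by
        have : v ≠ b.castSucc := by rintro rfl; exact hv e3
        simp only [Fin.lt_def, Fin.le_def, ne_eq, Fin.ext_iff, Fin.val_castSucc,
          Fin.val_succ] at *
        omega)
      refine ⟨e, ?_, _, f4, _, ?_, f3, Or.inr ⟨rfl, rfl⟩⟩
      · rw [hF, Finset.mem_filter]
        simp only [Fin.lt_def, Fin.le_def, ne_eq, Fin.ext_iff, Fin.val_castSucc,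
          Fin.val_succ, Finset.mem_univ, true_and] at *
        omega
      · rw [hW₁, Finset.mem_Icc]
        simp only [Fin.lt_def, Fin.le_def, ne_eq, Fin.ext_iff, Fin.val_castSucc,
          Fin.val_succ] at *
        omega

/-- The two steps share a vertex, so three values, with at most `γ` choices in total, fix all their
ends. The common label of `a` and `b` then comes for free, leaving `γ * n ^ (m - 1)` up to
constants. -/
theorem card_mul_le_of_cherry (hr : RowBounded r B) {γ : ℕ} (hγ : CherryBounded r γ)
    {ι : Type*} [DecidableEq ι] {κ : Fin K → ι} {S : Finset (Fin (K + 1) → Fin n)}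
    (hS : ∀ p ∈ S, ∀ a b, κ a = κ b → r (pathStep p a) (pathStep p b))
    {a b : Fin K} (hab : κ a = κ b)
    (hpS : ∀ p ∈ S, p b.castSucc = p a.succ ∧ p b.succ ≠ p a.castSucc) :
    S.card * n ≤ γ * n ^ (Finset.univ.image κ).card * B ^ (2 * (K + 1)) := by
  classical
  rcases Nat.eq_zero_or_pos n with rfl | hn
  · simp
  set W₀ : Finset (Fin (K + 1)) := {a.castSucc, a.succ, b.succ, b.castSucc} with hW₀
  have h0 : restrictionCard S W₀ ≤ γ := by
    refine (restrictionCard_le_of_determined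
      (fun p => (p a.castSucc, p a.succ, p b.succ)) _ ?_ ?_).trans hγ
    · intro p hp
      simp only [Set.Finite.mem_toFinset, Set.mem_ofPred_eq]
      refine ⟨?_, (hpS p hp).2⟩
      have := hS p hp a b hab
      rwa [pathStep_apply, pathStep_apply, (hpS p hp).1] at this
    · intro p hp q hq h w hw
      simp only [Prod.mk.injEq] at h
      obtain ⟨h1, h2, h3⟩ := h
      simp only [hW₀, Finset.mem_insert, Finset.mem_singleton] at hw
      rcases hw with rfl | rfl | rfl | rfl
      · assumption
      · assumption
      · assumption
      · rw [(hpS p hp).1, (hpS q hq).1, h2]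
  have h1 := path_card_mul_le hr hS (W := W₀) ⟨a.castSucc, by simp [hW₀]⟩
  have hlab : 1 ≤ (labelsIn Fin.castSucc Fin.succ κ Finset.univ W₀).card := by
    refine Finset.card_pos.2 ⟨κ a, mem_labelsIn.2 ⟨a, Finset.mem_univ _, ?_, ?_, rfl⟩⟩ <;>
      simp [hW₀]
  calc S.card * n = S.card * n ^ 1 := by ring
    _ ≤ S.card * n ^ (labelsIn Fin.castSucc Fin.succ κ Finset.univ W₀).card := by
      gcongr
    _ ≤ _ := h1
    _ ≤ γ * n ^ (Finset.univ.image κ).card * B ^ (2 * (K + 1)) := by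
      gcongr
      · exact hr.one_le
      · omega

end Paths

theorem Real.natCast_pow_le_sqrt_pow {n a b : ℕ} (hn : 1 ≤ n) (h : 2 * a ≤ b) :
    (n : ℝ) ^ a ≤ √(n : ℝ) ^ b := by
  have h1 : (1 : ℝ) ≤ √(n : ℝ) := Real.one_le_sqrt.2 (by exact_mod_cast hn)
  calc (n : ℝ) ^ a = √(n : ℝ) ^ (2 * a) := by rw [pow_mul, Real.sq_sqrt (Nat.cast_nonneg n)]
    _ ≤ _ := pow_le_pow_right₀ h1 h

/-! ### Paths that are negligible at the scale `n ^ (K / 2 + 1)` -/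

section Paths

variable {n K : ℕ} {r : Setoid (Fin n × Fin n)} {B : ℕ}

open scoped Classical in
/-- The paths which meet fewer than `K / 2` classes. -/
noncomputable def fewClassPaths (r : Setoid (Fin n × Fin n)) (K : ℕ) :
    Finset (Fin (K + 1) → Fin n) :=
  Finset.univ.filter fun p => 2 * numClasses r (pathStep p) < K

open scoped Classical in
/-- The paths whose steps are paired by `r` and in which some pair of steps is not formed of a
step and its reversal. -/
noncomputable def badPairedPaths (r : Setoid (Fin n × Fin n)) (K : ℕ) :
    Finset (Fin (K + 1) → Fin n) :=
  Finset.univ.filter fun p => NoSingleClass r (pathStep p) ∧ 2 * numClasses r (pathStep p) = K ∧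
    ∃ a b, a ≠ b ∧ r (pathStep p a) (pathStep p b) ∧ pathStep p a ≠ (pathStep p b).swap

/-- There are finitely many patterns, and one with `m` classes has `O(n ^ (m + 1))` paths; `2 * m <
K` gives `2 * (m + 1) ≤ K + 1`. -/
theorem card_fewClassPaths_le (hr : RowBounded r B) :
    ((fewClassPaths r K).card : ℝ) ≤
      Fintype.card (Fin K → Finset (Fin K)) * (B : ℝ) ^ (K + 1) * √(n : ℝ) ^ (K + 1) := by
  classical
  rcases Nat.eq_zero_or_pos n with rfl | hn
  · have : fewClassPaths r K = ∅ := by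
      ext p
      exact (p 0).elim0
    rw [this]
    simp
  have h : ∀ κ : Fin K → Finset (Fin K),
      (((fewClassPaths r K).filter fun p => classPattern r (pathStep p) = κ).card : ℝ) ≤
        (B : ℝ) ^ (K + 1) * √(n : ℝ) ^ (K + 1) := by
    intro κ
    rcases Finset.eq_empty_or_nonempty
      ((fewClassPaths r K).filter fun p => classPattern r (pathStep p) = κ) with h | ⟨p, hp⟩
    · rw [h]
      simp only [Finset.card_empty, Nat.cast_zero]
      positivity
    have hlt : 2 * (Finset.univ.image κ).card < K := by
      obtain ⟨h1, rfl⟩ := Finset.mem_filter.1 hp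
      rw [← numClasses_eq_card]
      exact (Finset.mem_filter.1 h1).2
    have h1 := path_card_le (κ := κ) hr
      (S := (fewClassPaths r K).filter fun p => classPattern r (pathStep p) = κ) (by
        intro p hp a b hab
        rw [← (Finset.mem_filter.1 hp).2] at hab
        exact classPattern_eq_iff.1 hab)
    calc _ ≤ ((n * n ^ (Finset.univ.image κ).card * B ^ (K + 1) : ℕ) : ℝ) := by exact_mod_cast h1
      _ = (B : ℝ) ^ (K + 1) * (n : ℝ) ^ ((Finset.univ.image κ).card + 1) := by
        push_cast
        ring
      _ ≤ _ := by
        gcongr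
        exact Real.natCast_pow_le_sqrt_pow hn (by omega)
  rw [Finset.card_eq_sum_card_fiberwise (f := fun p => classPattern r (pathStep p))
    (t := Finset.univ) (fun _ _ => by simp), Nat.cast_sum]
  refine (Finset.sum_le_card_nsmul _ _ _ fun κ _ => h κ).trans ?_
  rw [Finset.card_univ, nsmul_eq_mul, mul_assoc]

/-- A path all of whose steps are undone in a noncrossing way is closed. -/
theorem path_eq_of_noncrossing {ι : Type*} {κ : Fin K → ι} {p : Fin (K + 1) → Fin n}
    (hexact : ∀ a b c, a ≠ b → a ≠ c → κ a = κ b → κ a = κ c → b = c)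
    (hnc : ∀ a b c, a < c → c < b → κ a = κ b → ∃ d, d ≠ c ∧ κ d = κ c ∧ a ≤ d ∧ d ≤ b)
    (m : ℕ) (x y : Fin (K + 1)) (hxy : x ≤ y) (hm : (y : ℕ) - x = m)
    (hinv : ∀ e : Fin K, x ≤ e.castSucc → e.succ ≤ y → ∃ d, d ≠ e ∧ κ d = κ e ∧
      x ≤ d.castSucc ∧ d.succ ≤ y ∧ pathStep p e = (pathStep p d).swap) : p x = p y := by
  induction m using Nat.strong_induction_on generalizing x y with
  | _ m ih =>
  rcases hxy.eq_or_lt with rfl | hlt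
  · rfl
  have hxK : (x : ℕ) < K := lt_of_lt_of_le hlt (Nat.lt_succ_iff.1 y.2)
  obtain ⟨e, rfl⟩ : ∃ e : Fin K, e.castSucc = x := ⟨⟨x, hxK⟩, rfl⟩
  obtain ⟨d, hde, hκ, hd1, hd2, hstep⟩ := hinv e le_rfl (Fin.castSucc_lt_iff_succ_le.1 hlt)
  have hed : e < d := lt_of_le_of_ne (Fin.castSucc_le_castSucc_iff.1 hd1) hde.symm
  have h1 : p e.castSucc = p d.succ := congrArg Prod.fst hstep
  rw [h1]
  -- The partner `d` of the first step brings the path back to its starting value, so the stretch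
  -- from `e` to `d` can be discarded.
  refine ih _ ?_ d.succ y hd2 rfl ?_
  · simp only [Fin.lt_def, Fin.le_def, Fin.val_castSucc, Fin.val_succ] at *
    omega
  · intro f hf1 hf2
    have hdf : d < f := by
      simp only [Fin.lt_def, Fin.le_def, Fin.val_castSucc, Fin.val_succ] at *
      omega
    obtain ⟨g, hgf, hκg, hg1, hg2, hgstep⟩ := hinv f
      (by simp only [Fin.lt_def, Fin.le_def, Fin.val_castSucc, Fin.val_succ] at *; omega) hf2
    refine ⟨g, hgf, hκg, ?_, hg2, hgstep⟩
    -- The partner `g` of a later step `f` cannot lie in the discarded stretch: `g = e` or `g = d`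
    -- would put three steps in one class, and a `g` strictly inside has its partner inside by
    -- noncrossing.
    by_contra hlt'
    have hgd : g ≤ d := by
      simp only [Fin.lt_def, Fin.le_def, Fin.val_castSucc, Fin.val_succ] at *
      omega
    have heg : e ≤ g := Fin.castSucc_le_castSucc_iff.1 hg1
    rcases hgd.eq_or_lt with rfl | hgd
    · exact (hed.trans hdf).ne (hexact g e f hed.ne' hgf hκ hκg)
    rcases heg.eq_or_lt with rfl | heg
    · exact hdf.ne (hexact e d f hde.symm hgf hκ.symm hκg)
    obtain ⟨h, hhg, hκh, hh1, hh2⟩ := hnc e d g heg hgd hκ.symm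
    have := hexact g h f hhg.symm hgf hκh.symm hκg
    exact absurd (this ▸ hh2) (not_le.2 hdf)

/-- Without a crossing, take a pair `a < b` that is not a step and its reversal, with `b - a`
minimal. All pairs nested inside are reversals by minimality, so the path from the end of `a` to the
start of `b` is closed. As the pair itself is not a reversal, its outer ends differ. -/
theorem exists_crossing_or_cherry {ι : Type*} {κ : Fin K → ι} {p : Fin (K + 1) → Fin n}
    (hexact : ∀ a b c, a ≠ b → a ≠ c → κ a = κ b → κ a = κ c → b = c)
    (hbad : ∃ a b, a ≠ b ∧ κ a = κ b ∧ pathStep p a ≠ (pathStep p b).swap) :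
    (∃ a b c, a < c ∧ c < b ∧ κ a = κ b ∧ (∀ e, a < e → e < b → κ e ≠ κ a) ∧
      (∀ e, a < e → e < b → e ≠ c → κ e ≠ κ c)) ∨
    ∃ a b, κ a = κ b ∧ p b.castSucc = p a.succ ∧ p b.succ ≠ p a.castSucc := by
  by_cases hnc : ∀ a b c, a < c → c < b → κ a = κ b → ∃ d, d ≠ c ∧ κ d = κ c ∧ a ≤ d ∧ d ≤ b
  · right
    have hbad' : ∃ m : ℕ, ∃ a b, a < b ∧ κ a = κ b ∧ pathStep p a ≠ (pathStep p b).swap ∧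
        (b : ℕ) - a = m := by
      obtain ⟨a, b, hab, hκ, hs⟩ := hbad
      rcases hab.lt_or_gt with h | h
      · exact ⟨_, a, b, h, hκ, hs, rfl⟩
      · refine ⟨_, b, a, h, hκ.symm, fun h' => hs ?_, rfl⟩
        rw [h', Prod.swap_swap]
    classical
    obtain ⟨a, b, hab, hκ, hs, hm⟩ := Nat.find_spec hbad'
    have hmin := fun k hk => Nat.find_min hbad' (m := k) hk
    rw [← hm] at hmin
    have hreturn : p a.succ = p b.castSucc := by
      refine path_eq_of_noncrossing hexact hnc _ _ _ ?_ rfl ?_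
      · simp only [Fin.lt_def, Fin.le_def, Fin.val_castSucc, Fin.val_succ] at *
        omega
      · intro e he1 he2
        have hae : a < e := by
          simp only [Fin.lt_def, Fin.le_def, Fin.val_castSucc, Fin.val_succ] at *
          omega
        have heb : e < b := by
          simp only [Fin.lt_def, Fin.le_def, Fin.val_castSucc, Fin.val_succ] at *
          omega
        obtain ⟨d, hde, hκd, hd1, hd2⟩ := hnc a b e hae heb hκ
        have hda : a < d := by
          refine lt_of_le_of_ne hd1 ?_
          rintro rfl
          exact heb.ne' (hexact a b e hab.ne hae.ne hκ hκd)
        have hdb : d < b := by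
          refine lt_of_le_of_ne hd2 ?_
          rintro rfl
          exact hae.ne (hexact d a e hab.ne' heb.ne' hκ.symm hκd)
        refine ⟨d, hde, hκd, ?_, ?_, ?_⟩
        · simp only [Fin.lt_def, Fin.le_def, Fin.val_castSucc, Fin.val_succ] at *
          omega
        · simp only [Fin.lt_def, Fin.le_def, Fin.val_castSucc, Fin.val_succ] at *
          omega
        · by_contra hns
          rcases hde.lt_or_gt with h | h
          · refine hmin (e - d) ?_ ⟨d, e, h, hκd, fun h' => hns ?_, rfl⟩
            · simp only [Fin.lt_def] at *
              omega
            · rw [h', Prod.swap_swap]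
          · refine hmin (d - e) ?_ ⟨e, d, h, hκd.symm, hns, rfl⟩
            simp only [Fin.lt_def] at *
            omega
    refine ⟨a, b, hκ, hreturn.symm, fun h => hs ?_⟩
    rw [pathStep_apply, pathStep_apply, Prod.swap_prod_mk, h, hreturn]
  · left
    push Not at hnc
    obtain ⟨a, b, c, hac, hcb, hκ, h⟩ := hnc
    refine ⟨a, b, c, hac, hcb, hκ, fun e he1 he2 h' => ?_, fun e he1 he2 hec h' => ?_⟩
    · exact he2.ne (hexact a e b he1.ne (hac.trans hcb).ne h'.symm hκ)
    · exact absurd he2.le (not_le.2 (h e hec h' he1.le))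

/-- The paths are sorted by their pattern and by the steps that witness a crossing (`S`) or a cherry
(`S'`); the number of such data depends on `K` only. -/
theorem card_badPairedPaths_mul_le (hr : RowBounded r B) {γ₁ γ₃ : ℕ} (h1 : StarBounded r γ₁)
    (h3 : CherryBounded r γ₃) :
    ((badPairedPaths r K).card : ℝ) * n ≤
      Fintype.card ((Fin K → Finset (Fin K)) × Fin K × Fin K × Fin K) * 2 *
        (B : ℝ) ^ (2 * (K + 1)) * (γ₁ + γ₃) * √(n : ℝ) ^ K := by
  classical
  let Q : (Fin K → Finset (Fin K)) × Fin K × Fin K × Fin K → Finset (Fin (K + 1) → Fin n) :=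
    fun t => Finset.univ.filter fun p => classPattern r (pathStep p) = t.1 ∧
      2 * (Finset.univ.image t.1).card = K
  let S : (Fin K → Finset (Fin K)) × Fin K × Fin K × Fin K → Finset (Fin (K + 1) → Fin n) :=
    fun t => (Q t).filter fun _ => t.2.1 < t.2.2.2 ∧ t.2.2.2 < t.2.2.1 ∧
      t.1 t.2.1 = t.1 t.2.2.1 ∧ (∀ e, t.2.1 < e → e < t.2.2.1 → t.1 e ≠ t.1 t.2.1) ∧
      (∀ e, t.2.1 < e → e < t.2.2.1 → e ≠ t.2.2.2 → t.1 e ≠ t.1 t.2.2.2)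
  let S' : (Fin K → Finset (Fin K)) × Fin K × Fin K × Fin K → Finset (Fin (K + 1) → Fin n) :=
    fun t => (Q t).filter fun p => t.1 t.2.1 = t.1 t.2.2.1 ∧
      p t.2.2.1.castSucc = p t.2.1.succ ∧ p t.2.2.1.succ ≠ p t.2.1.castSucc
  have hQ : ∀ t, ∀ p ∈ Q t, ∀ a b, t.1 a = t.1 b → r (pathStep p a) (pathStep p b) := by
    intro t p hp a b hab
    rw [← (Finset.mem_filter.1 hp).2.1] at hab
    exact classPattern_eq_iff.1 hab
  have hpow : ∀ t, ∀ p ∈ Q t, (n : ℝ) ^ (Finset.univ.image t.1).card = √(n : ℝ) ^ K := by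
    intro t p hp
    rw [show √(n : ℝ) ^ K = √(n : ℝ) ^ (2 * (Finset.univ.image t.1).card) by
      rw [(Finset.mem_filter.1 hp).2.2], pow_mul, Real.sq_sqrt (Nat.cast_nonneg n)]
  have hS : ∀ t, ((S t).card : ℝ) * n ≤ (B : ℝ) ^ (2 * (K + 1)) * (γ₁ + γ₃) * √(n : ℝ) ^ K := by
    intro t
    rcases (S t).eq_empty_or_nonempty with h | ⟨p, hp⟩
    · rw [h]
      simp only [Finset.card_empty, Nat.cast_zero, zero_mul]
      positivity
    obtain ⟨hpQ, e1, e2, e3, e4, e5⟩ := Finset.mem_filter.1 hp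
    have := card_mul_le_of_crossing hr h1
      (fun p hp => hQ t p (Finset.mem_filter.1 hp).1 : ∀ p ∈ S t, _) e1 e2 e3 e4 e5
    calc ((S t).card : ℝ) * n
        ≤ (γ₁ * n ^ (Finset.univ.image t.1).card * B ^ (2 * (K + 1)) : ℕ) := by exact_mod_cast this
      _ = (B : ℝ) ^ (2 * (K + 1)) * γ₁ * √(n : ℝ) ^ K := by
        push_cast
        rw [hpow t p hpQ]
        ring
      _ ≤ _ := by
        gcongr
        linarith [(Nat.cast_nonneg γ₃ : (0 : ℝ) ≤ γ₃)]
  have hS' : ∀ t, ((S' t).card : ℝ) * n ≤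
      (B : ℝ) ^ (2 * (K + 1)) * (γ₁ + γ₃) * √(n : ℝ) ^ K := by
    intro t
    rcases (S' t).eq_empty_or_nonempty with h | ⟨p, hp⟩
    · rw [h]
      simp only [Finset.card_empty, Nat.cast_zero, zero_mul]
      positivity
    obtain ⟨hpQ, e1, -⟩ := Finset.mem_filter.1 hp
    have := card_mul_le_of_cherry hr h3
      (fun p hp => hQ t p (Finset.mem_filter.1 hp).1 : ∀ p ∈ S' t, _) e1
      (fun p hp => (Finset.mem_filter.1 hp).2.2)
    calc ((S' t).card : ℝ) * n
        ≤ (γ₃ * n ^ (Finset.univ.image t.1).card * B ^ (2 * (K + 1)) : ℕ) := by exact_mod_cast this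
      _ = (B : ℝ) ^ (2 * (K + 1)) * γ₃ * √(n : ℝ) ^ K := by
        push_cast
        rw [hpow t p hpQ]
        ring
      _ ≤ _ := by
        gcongr
        linarith [(Nat.cast_nonneg γ₁ : (0 : ℝ) ≤ γ₁)]
  have hcover : badPairedPaths r K ⊆ Finset.univ.biUnion fun t => S t ∪ S' t := by
    intro p hp
    obtain ⟨-, hns, hnum, a, b, hab, hrab, hne⟩ := Finset.mem_filter.1 hp
    have hexact : ∀ a b c, a ≠ b → a ≠ c →
        classPattern r (pathStep p) a = classPattern r (pathStep p) b →
        classPattern r (pathStep p) a = classPattern r (pathStep p) c → b = c := by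
      intro a b c hab hac h1 h2
      by_contra hbc
      have := hns.two_mul_numClasses_lt hab hac hbc (r.symm (classPattern_eq_iff.1 h1))
        (r.symm (classPattern_eq_iff.1 h2))
      rw [hnum, Fintype.card_fin] at this
      exact lt_irrefl _ this
    have hpQ : ∀ a b c, p ∈ Q (classPattern r (pathStep p), a, b, c) := fun a b c =>
      Finset.mem_filter.2 ⟨Finset.mem_univ _, rfl,
        (congrArg (2 * ·) (numClasses_eq_card r (pathStep p))).symm.trans hnum⟩
    rw [Finset.mem_biUnion]
    rcases exists_crossing_or_cherry hexact ⟨a, b, hab, classPattern_eq_iff.2 hrab, hne⟩ with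
      ⟨a, b, c, h⟩ | ⟨a, b, h⟩
    · exact ⟨(classPattern r (pathStep p), a, b, c), Finset.mem_univ _,
        Finset.mem_union_left _ (Finset.mem_filter.2 ⟨hpQ a b c, h⟩)⟩
    -- A cherry involves two steps only; the last component is filled arbitrarily with `b`.
    · exact ⟨(classPattern r (pathStep p), a, b, b), Finset.mem_univ _,
        Finset.mem_union_right _ (Finset.mem_filter.2 ⟨hpQ a b b, h⟩)⟩
  have hcard : ((badPairedPaths r K).card : ℝ) ≤ ∑ t, (((S t).card : ℝ) + (S' t).card) := by
    have := (Finset.card_le_card hcover).trans (Finset.card_biUnion_le.trans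
      (Finset.sum_le_sum fun t _ => Finset.card_union_le (S t) (S' t)))
    exact_mod_cast this
  calc ((badPairedPaths r K).card : ℝ) * n
      ≤ (∑ t, (((S t).card : ℝ) + (S' t).card)) * n := by gcongr
    _ = ∑ t, (((S t).card : ℝ) * n + (S' t).card * n) := by
      rw [Finset.sum_mul]
      exact Finset.sum_congr rfl fun t _ => by ring
    _ ≤ ∑ _t : (Fin K → Finset (Fin K)) × Fin K × Fin K × Fin K,
        (2 * ((B : ℝ) ^ (2 * (K + 1)) * (γ₁ + γ₃) * √(n : ℝ) ^ K)) :=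
      Finset.sum_le_sum fun t _ => by linarith [hS t, hS' t]
    _ = _ := by
      rw [Finset.sum_const, Finset.card_univ, nsmul_eq_mul]
      ring

end Paths

/-! ### Pairs of paths with a common class -/

section Loops

variable {n j l : ℕ} {r : Setoid (Fin n × Fin n)} {B : ℕ}

/-- The steps of a pair of paths. -/
def pairStep (p : Fin (j + 1) ⊕ Fin (l + 1) → Fin n) : Fin j ⊕ Fin l → Fin n × Fin n :=
  stepOf (Sum.map Fin.castSucc Fin.castSucc) (Sum.map Fin.succ Fin.succ) p

open scoped Classical in
/-- The pairs of paths, the first of them closed, which have a class in common and meet no class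
exactly once. -/
noncomputable def linkedLoops (r : Setoid (Fin n × Fin n)) (j l : ℕ) :
    Finset (Fin (j + 1) ⊕ Fin (l + 1) → Fin n) :=
  Finset.univ.filter fun p => p (Sum.inl 0) = p (Sum.inl (Fin.last j)) ∧
    NoSingleClass r (pairStep p) ∧ ∃ a b, r (pairStep p (Sum.inl a)) (pairStep p (Sum.inr b))

/-- A closed path stays connected when the step `a` is removed. Its vertices are thus explored from
one free vertex without paying for the label of `a`, which no other step of this path carries. The
label saved offsets the free starting vertex of the second path. -/
theorem card_mul_le_of_linked (hr : RowBounded r B) {ι : Type*} [DecidableEq ι]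
    {κ : Fin j ⊕ Fin l → ι} {S : Finset (Fin (j + 1) ⊕ Fin (l + 1) → Fin n)}
    (hS : ∀ p ∈ S, ∀ a b, κ a = κ b → r (pairStep p a) (pairStep p b))
    (hclosed : ∀ p ∈ S, p (Sum.inl 0) = p (Sum.inl (Fin.last j))) {a : Fin j}
    (ha : ∀ e, e ≠ a → κ (Sum.inl e) ≠ κ (Sum.inl a)) :
    S.card ≤ n * n ^ (Finset.univ.image κ).card * B ^ (2 * (j + l + 2)) := by
  classical
  rcases Nat.eq_zero_or_pos n with rfl | hn
  · have : S = ∅ := by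
      ext p
      exact (p (Sum.inl 0)).elim0
    simp [this]
  set src : Fin j ⊕ Fin l → Fin (j + 1) ⊕ Fin (l + 1) := Sum.map Fin.castSucc Fin.castSucc
  set tgt : Fin j ⊕ Fin l → Fin (j + 1) ⊕ Fin (l + 1) := Sum.map Fin.succ Fin.succ
  set W₀ : Finset (Fin (j + 1) ⊕ Fin (l + 1)) := {Sum.inl 0, Sum.inl (Fin.last j)} with hW₀
  set W₁ : Finset (Fin (j + 1) ⊕ Fin (l + 1)) := Finset.univ.image Sum.inl with hW₁
  set F : Finset (Fin j ⊕ Fin l) := (Finset.univ.erase a).image Sum.inl with hF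
  have hcardV : Fintype.card (Fin (j + 1) ⊕ Fin (l + 1)) = j + l + 2 := by
    rw [Fintype.card_sum, Fintype.card_fin, Fintype.card_fin]
    omega
  have h0 : restrictionCard S W₀ ≤ n := by
    refine (restrictionCard_le_of_determined (fun p => p (Sum.inl 0)) Finset.univ
      (fun _ _ => Finset.mem_univ _) ?_).trans (by simp)
    intro p hp q hq h w hw
    simp only [hW₀, Finset.mem_insert, Finset.mem_singleton] at hw
    rcases hw with rfl | rfl
    · exact h
    · rw [← hclosed p hp, ← hclosed q hq, h]
  have h1 := restrictionCard_mul_le hr hS F W₁ (W₀ := W₀) (by simp [hW₀, hW₁, Finset.insert_subset_iff]) ?_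
  · have hlab : (labelsIn src tgt κ F W₁).card + 1 ≤
        (labelsIn src tgt κ Finset.univ (insert (Sum.inr 0) W₁)).card := by
      have haF : κ (Sum.inl a) ∉ labelsIn src tgt κ F W₁ := by
        intro h
        obtain ⟨e, he, -, -, h⟩ := mem_labelsIn.1 h
        obtain ⟨f, hf, rfl⟩ := Finset.mem_image.1 he
        exact ha f (Finset.mem_erase.1 hf).1 h
      rw [← Finset.card_insert_of_notMem haF]
      refine Finset.card_le_card ?_
      intro x hx
      simp only [Finset.mem_insert, mem_labelsIn] at hx
      rw [mem_labelsIn]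
      rcases hx with rfl | ⟨e, -, he1, he2, he3⟩
      · exact ⟨Sum.inl a, Finset.mem_univ _, by simp [hW₁, src], by simp [hW₁, tgt], rfl⟩
      · exact ⟨e, Finset.mem_univ _, Finset.mem_insert_of_mem he1, Finset.mem_insert_of_mem he2,
          he3⟩
    have h2 := restrictionCard_mul_le hr hS Finset.univ Finset.univ
      (Finset.subset_univ (insert (Sum.inr 0) W₁)) ?_
    · have h3 := restrictionCard_insert_le_mul_card S W₁ (Sum.inr 0)
      rw [Fintype.card_fin] at h3
      rw [restrictionCard_univ] at h2
      have h4 : labelsIn src tgt κ Finset.univ Finset.univ = Finset.univ.image κ := by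
        ext x
        simp [mem_labelsIn]
      rw [h4] at h2
      set f := (labelsIn src tgt κ F W₁).card
      set m := (Finset.univ.image κ).card
      have hB : ∀ W W' : Finset (Fin (j + 1) ⊕ Fin (l + 1)), (W \ W').card ≤ j + l + 2 :=
        fun W W' => (Finset.card_le_univ _).trans hcardV.le
      have h5 : restrictionCard S W₁ ≤ n * n ^ f * B ^ (j + l + 2) := by
        calc restrictionCard S W₁ ≤ restrictionCard S W₁ * n ^ (labelsIn src tgt κ F W₀).card :=
              Nat.le_mul_of_pos_right _ (by positivity)
          _ ≤ _ := h1
          _ ≤ _ := by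
            gcongr
            · exact hr.one_le
            · exact hB _ _
      refine Nat.le_of_mul_le_mul_right (c := n ^ (f + 1)) ?_ (by positivity)
      calc S.card * n ^ (f + 1) ≤
            S.card * n ^ (labelsIn src tgt κ Finset.univ (insert (Sum.inr 0) W₁)).card := by
            gcongr
        _ ≤ _ := h2
        _ ≤ (n * n ^ f * B ^ (j + l + 2) * n) * n ^ m * B ^ (j + l + 2) := by
          gcongr
          · exact h3.trans (by gcongr)
          · exact hr.one_le
          · exact hB _ _
        _ = _ := by ring
    · intro W hW hlt
      obtain ⟨v, -, hv⟩ := Finset.exists_of_ssubset hlt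
      rcases v with v | v
      · exact absurd (hW (Finset.mem_insert_of_mem (by simp [hW₁]))) hv
      · set W' : Finset (Fin (l + 1)) := Finset.univ.filter fun x => Sum.inr x ∈ W with hW'
        have h00 : (0 : Fin (l + 1)) ∈ W' := by
          simpa [hW'] using hW (Finset.mem_insert_self _ _)
        have hv' : v ∉ W' := by simpa [hW'] using hv
        obtain ⟨e, -, -, h3, h4⟩ := Fin.exists_step_leaving h00 v hv' (by
          rw [Fin.pos_iff_ne_zero]
          rintro rfl
          exact hv' h00)
        exact ⟨Sum.inr e, Finset.mem_univ _, Sum.inr e.castSucc, by simpa [hW'] using h3,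
          Sum.inr e.succ, Finset.mem_univ _, by simpa [hW'] using h4, Or.inl ⟨rfl, rfl⟩⟩
  · intro W hW hlt
    obtain ⟨v, hv1, hv⟩ := Finset.exists_of_ssubset hlt
    obtain ⟨v, -, rfl⟩ := Finset.mem_image.1 hv1
    set W' : Finset (Fin (j + 1)) := Finset.univ.filter fun x => Sum.inl x ∈ W with hW'
    have hmem : ∀ x, x ∈ W' ↔ Sum.inl x ∈ W := fun x => by simp [hW']
    have h00 : (0 : Fin (j + 1)) ∈ W' := (hmem _).2 (hW (by simp [hW₀]))
    have hlast : Fin.last j ∈ W' := (hmem _).2 (hW (by simp [hW₀]))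
    have hv' : v ∉ W' := fun h => hv ((hmem _).1 h)
    have hFmem : ∀ e, e ≠ a → Sum.inl e ∈ F := fun e he => by simp [hF, he]
    -- Vertices before the missing step are reached forwards from the first vertex, the others
    -- backwards from the last one; by closedness both have the same known value.
    rcases le_or_gt v a.castSucc with hva | hva
    · obtain ⟨e, -, h2, h3, h4⟩ := Fin.exists_step_leaving h00 v hv' (by
        rw [Fin.pos_iff_ne_zero]
        rintro rfl
        exact hv' h00)
      refine ⟨Sum.inl e, hFmem e ?_, Sum.inl e.castSucc, (hmem _).1 h3, Sum.inl e.succ,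
        by simp [hW₁], fun h => h4 ((hmem _).2 h), Or.inl ⟨rfl, rfl⟩⟩
      rintro rfl
      exact absurd (h2.trans hva) (not_le.2 Fin.castSucc_lt_succ)
    · obtain ⟨e, h1, -, h3, h4⟩ := Fin.exists_step_entering hv' _ hlast (by
        refine lt_of_le_of_ne (Fin.le_last v) ?_
        rintro rfl
        exact hv' hlast)
      refine ⟨Sum.inl e, hFmem e ?_, Sum.inl e.succ, (hmem _).1 h4, Sum.inl e.castSucc,
        by simp [hW₁], fun h => h3 ((hmem _).2 h), Or.inr ⟨rfl, rfl⟩⟩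
      rintro rfl
      exact absurd h1 (not_le.2 hva)

theorem pair_card_le (hr : RowBounded r B) {ι : Type*} [DecidableEq ι]
    {κ : Fin j ⊕ Fin l → ι} {S : Finset (Fin (j + 1) ⊕ Fin (l + 1) → Fin n)}
    (hS : ∀ p ∈ S, ∀ a b, κ a = κ b → r (pairStep p a) (pairStep p b)) :
    S.card ≤ n * n * n ^ (Finset.univ.image κ).card * B ^ (j + l + 2) := by
  classical
  rcases Nat.eq_zero_or_pos n with rfl | hn
  · have : S = ∅ := by
      ext p
      exact (p (Sum.inl 0)).elim0
    simp [this]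
  set src : Fin j ⊕ Fin l → Fin (j + 1) ⊕ Fin (l + 1) := Sum.map Fin.castSucc Fin.castSucc
  set tgt : Fin j ⊕ Fin l → Fin (j + 1) ⊕ Fin (l + 1) := Sum.map Fin.succ Fin.succ
  set W₀ : Finset (Fin (j + 1) ⊕ Fin (l + 1)) := {Sum.inl 0, Sum.inr 0} with hW₀
  have h0 : restrictionCard S W₀ ≤ n * n := by
    refine (restrictionCard_le_of_determined (fun p => (p (Sum.inl 0), p (Sum.inr 0))) Finset.univ
      (fun _ _ => Finset.mem_univ _) ?_).trans (by simp [Finset.card_univ])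
    intro p hp q hq h w hw
    simp only [Prod.mk.injEq] at h
    simp only [hW₀, Finset.mem_insert, Finset.mem_singleton] at hw
    rcases hw with rfl | rfl
    · exact h.1
    · exact h.2
  have h1 := restrictionCard_mul_le hr hS Finset.univ Finset.univ (Finset.subset_univ W₀) ?_
  · have h4 : labelsIn src tgt κ Finset.univ Finset.univ = Finset.univ.image κ := by
      ext x
      simp [mem_labelsIn]
    rw [restrictionCard_univ, h4] at h1
    calc S.card ≤ S.card * n ^ (labelsIn src tgt κ Finset.univ W₀).card :=
          Nat.le_mul_of_pos_right _ (by positivity)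
      _ ≤ _ := h1
      _ ≤ _ := by
        gcongr
        · exact hr.one_le
        · refine (Finset.card_le_univ _).trans ?_
          rw [Fintype.card_sum, Fintype.card_fin, Fintype.card_fin]
          omega
  · intro W hW hlt
    obtain ⟨v, -, hv⟩ := Finset.exists_of_ssubset hlt
    rcases v with v | v
    · set W' : Finset (Fin (j + 1)) := Finset.univ.filter fun x => Sum.inl x ∈ W with hW'
      have h00 : (0 : Fin (j + 1)) ∈ W' := by
        simpa [hW'] using hW (by simp [hW₀])
      have hv' : v ∉ W' := by simpa [hW'] using hv
      obtain ⟨e, -, -, h3, h4⟩ := Fin.exists_step_leaving h00 v hv' (by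
        rw [Fin.pos_iff_ne_zero]
        rintro rfl
        exact hv' h00)
      exact ⟨Sum.inl e, Finset.mem_univ _, Sum.inl e.castSucc, by simpa [hW'] using h3,
        Sum.inl e.succ, Finset.mem_univ _, by simpa [hW'] using h4, Or.inl ⟨rfl, rfl⟩⟩
    · set W' : Finset (Fin (l + 1)) := Finset.univ.filter fun x => Sum.inr x ∈ W with hW'
      have h00 : (0 : Fin (l + 1)) ∈ W' := by
        simpa [hW'] using hW (by simp [hW₀])
      have hv' : v ∉ W' := by simpa [hW'] using hv
      obtain ⟨e, -, -, h3, h4⟩ := Fin.exists_step_leaving h00 v hv' (by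
        rw [Fin.pos_iff_ne_zero]
        rintro rfl
        exact hv' h00)
      exact ⟨Sum.inr e, Finset.mem_univ _, Sum.inr e.castSucc, by simpa [hW'] using h3,
        Sum.inr e.succ, Finset.mem_univ _, by simpa [hW'] using h4, Or.inl ⟨rfl, rfl⟩⟩

/-- Let `a` and `b` be steps of the two paths in a common class. If `a` is alone in its class within
the first path, `card_mul_le_of_linked` saves a factor `n`. Otherwise the class contains three
steps, so there are strictly fewer than `(j + l) / 2` classes and `pair_card_le` suffices. -/
theorem card_linkedLoops_le (hr : RowBounded r B) :
    ((linkedLoops r j l).card : ℝ) ≤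
      Fintype.card ((Fin j ⊕ Fin l → Finset (Fin j ⊕ Fin l)) × Fin j × Fin l) *
        (B : ℝ) ^ (2 * (j + l + 2)) * √(n : ℝ) ^ (j + l + 3) := by
  classical
  rcases Nat.eq_zero_or_pos n with rfl | hn
  · have : linkedLoops r j l = ∅ := by
      ext p
      exact (p (Sum.inl 0)).elim0
    rw [this]
    simp
  let S : (Fin j ⊕ Fin l → Finset (Fin j ⊕ Fin l)) × Fin j × Fin l →
      Finset (Fin (j + 1) ⊕ Fin (l + 1) → Fin n) := fun t =>
    (linkedLoops r j l).filter fun p => classPattern r (pairStep p) = t.1 ∧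
      r (pairStep p (Sum.inl t.2.1)) (pairStep p (Sum.inr t.2.2))
  have hS : ∀ t, ((S t).card : ℝ) ≤
      (B : ℝ) ^ (2 * (j + l + 2)) * √(n : ℝ) ^ (j + l + 3) := by
    rintro ⟨κ, a, b⟩
    rcases (S (κ, a, b)).eq_empty_or_nonempty with h | ⟨p, hp⟩
    · rw [h]
      simp only [Finset.card_empty, Nat.cast_zero]
      positivity
    obtain ⟨hp1, hpκ, hab⟩ := Finset.mem_filter.1 hp
    obtain ⟨-, -, hns, -⟩ := Finset.mem_filter.1 hp1
    have hκS : ∀ p ∈ S (κ, a, b), ∀ x y, κ x = κ y → r (pairStep p x) (pairStep p y) := by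
      intro p hp x y hxy
      obtain ⟨-, hκ, -⟩ := Finset.mem_filter.1 hp
      change classPattern r (pairStep p) = κ at hκ
      rw [← hκ] at hxy
      exact classPattern_eq_iff.1 hxy
    change classPattern r (pairStep p) = κ at hpκ
    have hB : (1 : ℝ) ≤ B := by exact_mod_cast hr.one_le
    have hle : 2 * (Finset.univ.image κ).card ≤ j + l := by
      have := hns.two_mul_numClasses_le
      rwa [numClasses_eq_card, hpκ, Fintype.card_sum, Fintype.card_fin, Fintype.card_fin] at this
    by_cases ha : ∀ e, e ≠ a → κ (Sum.inl e) ≠ κ (Sum.inl a)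
    · have := card_mul_le_of_linked hr hκS (fun p hp =>
        (Finset.mem_filter.1 (Finset.mem_filter.1 hp).1).2.1) ha
      calc ((S (κ, a, b)).card : ℝ)
          ≤ ((n * n ^ (Finset.univ.image κ).card * B ^ (2 * (j + l + 2)) : ℕ) : ℝ) := by
            exact_mod_cast this
        _ = (B : ℝ) ^ (2 * (j + l + 2)) * (n : ℝ) ^ ((Finset.univ.image κ).card + 1) := by
          push_cast
          ring
        _ ≤ _ := by
          gcongr
          exact Real.natCast_pow_le_sqrt_pow hn (by omega)
    · push Not at ha
      obtain ⟨e, hea, hκe⟩ := ha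
      have hlt : 2 * (Finset.univ.image κ).card < j + l := by
        have := hns.two_mul_numClasses_lt (x := Sum.inl a) (y := Sum.inl e) (z := Sum.inr b)
          (by simpa using hea.symm) (by simp) (by simp)
          (by rw [← hpκ] at hκe; exact classPattern_eq_iff.1 hκe) (r.symm hab)
        rwa [numClasses_eq_card, hpκ, Fintype.card_sum, Fintype.card_fin, Fintype.card_fin] at this
      have := pair_card_le hr hκS
      calc ((S (κ, a, b)).card : ℝ)
          ≤ ((n * n * n ^ (Finset.univ.image κ).card * B ^ (j + l + 2) : ℕ) : ℝ) := by
            exact_mod_cast this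
        _ = (B : ℝ) ^ (j + l + 2) * (n : ℝ) ^ ((Finset.univ.image κ).card + 2) := by
          push_cast
          ring
        _ ≤ _ := by
          gcongr
          · omega
          · exact Real.natCast_pow_le_sqrt_pow hn (by omega)
  have hcover : linkedLoops r j l ⊆ Finset.univ.biUnion S := by
    intro p hp
    obtain ⟨-, -, -, a, b, hab⟩ := Finset.mem_filter.1 hp
    exact Finset.mem_biUnion.2 ⟨(classPattern r (pairStep p), a, b), Finset.mem_univ _,
      Finset.mem_filter.2 ⟨hp, rfl, hab⟩⟩
  have hcard : ((linkedLoops r j l).card : ℝ) ≤ ∑ t, ((S t).card : ℝ) := by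
    exact_mod_cast (Finset.card_le_card hcover).trans Finset.card_biUnion_le
  refine hcard.trans ((Finset.sum_le_card_nsmul _ _ _ fun t _ => hS t).trans ?_)
  rw [Finset.card_univ, nsmul_eq_mul, mul_assoc]

end Loops

/-! ### Expectations of products of entries -/

section EntryProd

variable {Ω : Type*} {n : ℕ} {E E' : Type*}

/-- The product of the entries at the positions `q e`, `e ∈ s`. -/
def entryProd (X : Ω → Matrix (Fin n) (Fin n) ℂ) (q : E → Fin n × Fin n) (s : Finset E) (ω : Ω) :
    ℂ :=
  ∏ e ∈ s, X ω (q e).1 (q e).2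

variable [MeasurableSpace Ω] {μ : Measure Ω} {X : Ω → Matrix (Fin n) (Fin n) ℂ}
  {r : Setoid (Fin n × Fin n)}

theorem measurable_entryProd (hX : ∀ i j, Measurable fun ω => X ω i j) (q : E → Fin n × Fin n)
    (s : Finset E) : Measurable (entryProd X q s) := by
  unfold entryProd
  exact Finset.measurable_prod s fun e _ => hX _ _

/-- The two products are measurable functions of the entry vectors of two disjoint finite sets of
classes. -/
theorem IndependentClasses.indepFun_entryProd (hindep : IndependentClasses μ X r)
    (hX : ∀ i j, Measurable fun ω => X ω i j) {q : E → Fin n × Fin n} {q' : E' → Fin n × Fin n}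
    {s : Finset E} {t : Finset E'} (h : ∀ a ∈ s, ∀ b ∈ t, ¬ r (q a) (q' b)) :
    IndepFun (entryProd X q s) (entryProd X q' t) μ := by
  classical
  let S : Finset (Quotient r) := s.image fun e => Quotient.mk r (q e)
  let T : Finset (Quotient r) := t.image fun e => Quotient.mk r (q' e)
  have hST : Disjoint S T := by
    rw [Finset.disjoint_left]
    intro c hc hc'
    obtain ⟨a, ha, rfl⟩ := Finset.mem_image.1 hc
    obtain ⟨b, hb, hab⟩ := Finset.mem_image.1 hc'
    exact h a ha b hb (r.symm (Quotient.exact hab))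
  have hind := iIndepFun.indepFun_finset S T hST hindep
    (fun c => measurable_pi_lambda _ fun p => hX _ _)
  let φ : ((c : S) → ({p : Fin n × Fin n // Quotient.mk r p = c} → ℂ)) → ℂ := fun g =>
    ∏ e : s, g ⟨Quotient.mk r (q e), Finset.mem_image_of_mem _ e.2⟩ ⟨q e, rfl⟩
  let ψ : ((c : T) → ({p : Fin n × Fin n // Quotient.mk r p = c} → ℂ)) → ℂ := fun g =>
    ∏ e : t, g ⟨Quotient.mk r (q' e), Finset.mem_image_of_mem _ e.2⟩ ⟨q' e, rfl⟩
  have hφ : Measurable φ := Finset.measurable_prod _ fun e _ =>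
    (measurable_pi_apply _).comp (measurable_pi_apply _)
  have hψ : Measurable ψ := Finset.measurable_prod _ fun e _ =>
    (measurable_pi_apply _).comp (measurable_pi_apply _)
  have := hind.comp hφ hψ
  convert this using 1
  · funext ω
    exact (Finset.prod_coe_sort s fun e => X ω (q e).1 (q e).2).symm
  · funext ω
    exact (Finset.prod_coe_sort t fun e => X ω (q' e).1 (q' e).2).symm

theorem IndependentClasses.integral_entryProd_mul (hindep : IndependentClasses μ X r)
    (hX : ∀ i j, Measurable fun ω => X ω i j) {q : E → Fin n × Fin n} {q' : E' → Fin n × Fin n}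
    {s : Finset E} {t : Finset E'} (h : ∀ a ∈ s, ∀ b ∈ t, ¬ r (q a) (q' b)) :
    ∫ ω, entryProd X q s ω * entryProd X q' t ω ∂μ =
      (∫ ω, entryProd X q s ω ∂μ) * ∫ ω, entryProd X q' t ω ∂μ :=
  (hindep.indepFun_entryProd hX h).integral_fun_mul_eq_mul_integral
    (measurable_entryProd hX q s).aestronglyMeasurable
    (measurable_entryProd hX q' t).aestronglyMeasurable

theorem IndependentClasses.integral_entryProd_eq_zero (hindep : IndependentClasses μ X r)
    (hX : ∀ i j, Measurable fun ω => X ω i j) (hmean : ∀ i j, ∫ ω, X ω i j ∂μ = 0)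
    {q : E → Fin n × Fin n} {s : Finset E} {a : E} (ha : a ∈ s)
    (h : ∀ b ∈ s, b ≠ a → ¬ r (q b) (q a)) : ∫ ω, entryProd X q s ω ∂μ = 0 := by
  classical
  have hsplit : ∀ ω, entryProd X q s ω = entryProd X q {a} ω * entryProd X q (s.erase a) ω := by
    intro ω
    simp only [entryProd, Finset.prod_singleton]
    exact (Finset.mul_prod_erase s (fun e => X ω (q e).1 (q e).2) ha).symm
  simp_rw [hsplit]
  rw [hindep.integral_entryProd_mul hX]
  · simp [entryProd, hmean]
  · intro b hb c hc hbc
    rw [Finset.mem_singleton.1 hb] at hbc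
    exact h c (Finset.mem_of_mem_erase hc) (Finset.ne_of_mem_erase hc) (r.symm hbc)

theorem Matrix.IsHermitian.apply_mul_apply_swap {A : Matrix (Fin n) (Fin n) ℂ}
    (hA : A.IsHermitian) (i j : Fin n) : A i j * A j i = ((‖A i j‖ ^ 2 : ℝ) : ℂ) := by
  rw [← hA.apply j i, ← starRingEnd_apply, Complex.mul_conj, Complex.normSq_eq_norm_sq]

theorem integral_mul_swap_eq_one (hherm : ∀ ω, (X ω).IsHermitian)
    (hvar : ∀ i j, ∫ ω, ‖X ω i j‖ ^ 2 ∂μ = 1) (i j : Fin n) :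
    ∫ ω, X ω i j * X ω j i ∂μ = 1 := by
  simp_rw [fun ω => (hherm ω).apply_mul_apply_swap i j]
  rw [integral_complex_ofReal, hvar, Complex.ofReal_one]

/-- Otherwise an entry and its conjugate would be independent, and the variance `1` would equal a
product of two zero means. Symmetry of the relation under exchange of coordinates thus need not be
assumed. -/
theorem IndependentClasses.rel_swap (hindep : IndependentClasses μ X r)
    (hX : ∀ i j, Measurable fun ω => X ω i j) (hmean : ∀ i j, ∫ ω, X ω i j ∂μ = 0)
    (hherm : ∀ ω, (X ω).IsHermitian) (hvar : ∀ i j, ∫ ω, ‖X ω i j‖ ^ 2 ∂μ = 1) (i j : Fin n) :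
    r (i, j) (j, i) := by
  by_contra h
  have h1 := hindep.integral_entryProd_mul hX (q := fun _ : Unit => (i, j))
    (q' := fun _ : Unit => (j, i)) (s := {()}) (t := {()}) (by simpa using h)
  simp only [entryProd, Finset.prod_singleton, hmean] at h1
  rw [integral_mul_swap_eq_one hherm hvar] at h1
  simp at h1

/-- A crude substitute for Hölder's inequality: a product is at most a power of its largest factor.
The `1` accounts for the empty product. -/
theorem enorm_prod_le_one_add_sum (z : E → ℂ) (s : Finset E) :
    ‖∏ e ∈ s, z e‖ₑ ≤ 1 + ∑ e ∈ s, ‖z e‖ₑ ^ s.card := by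
  rcases s.eq_empty_or_nonempty with rfl | hs
  · simp
  obtain ⟨a, ha, hmax⟩ := Finset.exists_max_image s (fun e => ‖z e‖ₑ) hs
  have h1 : ‖∏ e ∈ s, z e‖ₑ = ∏ e ∈ s, ‖z e‖ₑ := by
    simp [enorm_eq_nnnorm, nnnorm_prod]
  calc ‖∏ e ∈ s, z e‖ₑ = ∏ e ∈ s, ‖z e‖ₑ := h1
    _ ≤ ‖z a‖ₑ ^ s.card := Finset.prod_le_pow_card _ _ _ hmax
    _ ≤ ∑ e ∈ s, ‖z e‖ₑ ^ s.card := Finset.single_le_sum (f := fun e => ‖z e‖ₑ ^ s.card)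
        (fun _ _ => zero_le) ha
    _ ≤ _ := le_add_self

end EntryProd

/-- Products of at most `m` entries are integrable, with uniformly bounded integrals. -/
theorem CondC0.exists_bound_entryProd {Ω : ℕ → Type*} [∀ n, MeasurableSpace (Ω n)]
    {P : ∀ n, Measure (Ω n)} [∀ n, IsProbabilityMeasure (P n)]
    {X : ∀ n, Ω n → Matrix (Fin n) (Fin n) ℂ} (hC0 : CondC0 P X)
    (hmeas : ∀ n (i j : Fin n), Measurable fun ω => X n ω i j) (m : ℕ) :
    ∃ M : ℝ, 0 ≤ M ∧ ∀ (n : ℕ) (E : Type) (q : E → Fin n × Fin n) (s : Finset E), s.card ≤ m →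
      Integrable (entryProd (X n) q s) (P n) ∧ ‖∫ ω, entryProd (X n) q s ω ∂(P n)‖ ≤ M := by
  choose C hC using hC0
  -- The moment used is the one of order `s.card`; summing over all orders up to `m` makes the bound
  -- independent of `s`.
  refine ⟨∑ c ∈ Finset.range (m + 1), (1 + c * (C c : ℝ)), by positivity, ?_⟩
  intro n E q s hs
  have h1 : ∫⁻ ω, ‖entryProd (X n) q s ω‖ₑ ∂(P n) ≤ ((1 + s.card * C s.card : ℝ≥0) : ℝ≥0∞) := by
    calc ∫⁻ ω, ‖entryProd (X n) q s ω‖ₑ ∂(P n)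
        ≤ ∫⁻ ω, (1 + ∑ e ∈ s, ‖X n ω (q e).1 (q e).2‖ₑ ^ s.card) ∂(P n) :=
          lintegral_mono fun ω => enorm_prod_le_one_add_sum _ s
      _ = 1 + ∑ e ∈ s, ∫⁻ ω, ‖X n ω (q e).1 (q e).2‖ₑ ^ s.card ∂(P n) := by
        rw [lintegral_add_left measurable_const, lintegral_finsetSum]
        · simp
        · exact fun e _ => (hmeas n _ _).enorm.pow_const _
      _ ≤ 1 + ∑ e ∈ s, (C s.card : ℝ≥0∞) := by
        gcongr with e _
        exact hC _ _ _ _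
      _ = _ := by simp
  have hint : Integrable (entryProd (X n) q s) (P n) :=
    ⟨(measurable_entryProd (hmeas n) q s).aestronglyMeasurable,
      h1.trans_lt ENNReal.coe_lt_top⟩
  refine ⟨hint, ?_⟩
  have h2 : ‖∫ ω, entryProd (X n) q s ω ∂(P n)‖ ≤ 1 + s.card * (C s.card : ℝ) := by
    have h3 := (enorm_integral_le_lintegral_enorm (entryProd (X n) q s) (μ := P n)).trans h1
    rw [← ofReal_norm] at h3
    have := (ENNReal.ofReal_le_iff_le_toReal ENNReal.coe_ne_top).1 h3
    rw [ENNReal.coe_toReal] at this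
    exact_mod_cast this
  exact h2.trans (Finset.single_le_sum (f := fun c : ℕ => 1 + c * (C c : ℝ))
    (fun c _ => by positivity) (Finset.mem_range_succ_iff.2 hs))

/-! ### Traces of powers as sums over closed paths -/

theorem Matrix.pow_apply_eq_sum_paths {R : Type*} [CommSemiring R] {n : ℕ}
    (A : Matrix (Fin n) (Fin n) R) (k : ℕ) (i j : Fin n) :
    (A ^ k) i j = ∑ p : Fin (k + 1) → Fin n, if p 0 = i ∧ p (Fin.last k) = j then
      ∏ e, A (pathStep p e).1 (pathStep p e).2 else 0 := by
  induction k generalizing i with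
  | zero =>
    rw [pow_zero, Matrix.one_apply, ← (Equiv.funUnique (Fin 1) (Fin n)).symm.sum_comp]
    simp only [Equiv.funUnique_symm_apply, uniqueElim_const, Finset.univ_eq_empty,
      Finset.prod_empty, ite_and]
    simp
  | succ k ih =>
    have hcons : ∀ F : (Fin (k + 2) → Fin n) → R,
        ∑ p, F p = ∑ x : Fin n, ∑ p : Fin (k + 1) → Fin n, F (Fin.cons x p) := by
      intro F
      rw [← (Fin.consEquiv fun _ => Fin n).sum_comp, Fintype.sum_prod_type]
      rfl
    have hprod : ∀ (x : Fin n) (p : Fin (k + 1) → Fin n),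
        ∏ e : Fin (k + 1), A (pathStep (Fin.cons x p : Fin (k + 2) → Fin n) e).1
          (pathStep (Fin.cons x p : Fin (k + 2) → Fin n) e).2 =
        A x (p 0) * ∏ e, A (pathStep p e).1 (pathStep p e).2 := by
      intro x p
      rw [Fin.prod_univ_succ]
      rfl
    rw [pow_succ', Matrix.mul_apply, hcons]
    simp only [Fin.cons_zero, ite_and, ← Fin.succ_last, Fin.cons_succ, hprod]
    symm
    rw [Finset.sum_eq_single i (fun x _ hx => by simp [hx]) (by simp)]
    simp only [if_true, ih, Finset.mul_sum]
    symm
    rw [Finset.sum_comm]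
    refine Finset.sum_congr rfl fun p _ => ?_
    rw [Finset.sum_eq_single (p 0) (fun x _ hx => by simp [hx.symm]) (by simp)]
    simp

/-- The closed paths with `k` steps. -/
def closedPaths (n k : ℕ) : Finset (Fin (k + 1) → Fin n) :=
  Finset.univ.filter fun p => p 0 = p (Fin.last k)

/-- The pairs of closed paths. -/
def closedPairs (n j l : ℕ) : Finset (Fin (j + 1) ⊕ Fin (l + 1) → Fin n) :=
  Finset.univ.filter fun p => p (Sum.inl 0) = p (Sum.inl (Fin.last j)) ∧
    p (Sum.inr 0) = p (Sum.inr (Fin.last l))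

theorem trace_pow_eq_sum_entryProd {Ω : Type*} {n : ℕ} (X : Ω → Matrix (Fin n) (Fin n) ℂ) (k : ℕ)
    (ω : Ω) : (X ω ^ k).trace =
      ∑ p ∈ closedPaths n k, entryProd X (pathStep p) Finset.univ ω := by
  simp only [Matrix.trace, Matrix.diag_apply, Matrix.pow_apply_eq_sum_paths, closedPaths]
  rw [Finset.sum_comm, Finset.sum_filter]
  refine Finset.sum_congr rfl fun p _ => ?_
  rw [Finset.sum_eq_single (p 0) (fun x _ hx => by simp [hx.symm]) (by simp)]
  simp [entryProd, eq_comm]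

theorem entryProd_pairStep {Ω : Type*} {n j l : ℕ} (X : Ω → Matrix (Fin n) (Fin n) ℂ)
    (p : Fin (j + 1) ⊕ Fin (l + 1) → Fin n) (ω : Ω) :
    entryProd X (pairStep p) Finset.univ ω =
      entryProd X (pathStep (p ∘ Sum.inl)) Finset.univ ω *
        entryProd X (pathStep (p ∘ Sum.inr)) Finset.univ ω := by
  rw [entryProd, Fintype.prod_sum_type]
  rfl

theorem trace_pow_mul_trace_pow_eq_sum {R : Type*} [CommSemiring R] {n : ℕ} (j l : ℕ)
    (f : (Fin (j + 1) → Fin n) → R) (g : (Fin (l + 1) → Fin n) → R) :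
    (∑ p ∈ closedPaths n j, f p) * (∑ p ∈ closedPaths n l, g p) =
      ∑ p ∈ closedPairs n j l, f (p ∘ Sum.inl) * g (p ∘ Sum.inr) := by
  rw [Finset.sum_mul_sum, ← Finset.sum_product']
  refine Finset.sum_nbij' (fun x => Sum.elim x.1 x.2) (fun p => (p ∘ Sum.inl, p ∘ Sum.inr))
    ?_ ?_ ?_ ?_ ?_
  · intro x hx
    simpa [closedPaths, closedPairs] using hx
  · intro x hx
    simpa [closedPaths, closedPairs] using hx
  · intro x _
    rfl
  · intro x _
    exact Sum.elim_comp_inl_inr x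
  · intro x _
    rfl

/-! ### The recursion for the expected traces -/

/-- A random Hermitian matrix with centered entries of variance one, independent across the
classes of `r`. -/
structure StandardEntries {Ω : Type*} {n : ℕ} [MeasurableSpace Ω] (μ : Measure Ω)
    (X : Ω → Matrix (Fin n) (Fin n) ℂ) (r : Setoid (Fin n × Fin n)) : Prop where
  meas : ∀ i j, Measurable fun ω => X ω i j
  herm : ∀ ω, (X ω).IsHermitian
  indep : IndependentClasses μ X r
  mean : ∀ i j, ∫ ω, X ω i j ∂μ = 0
  var : ∀ i j, ∫ ω, ‖X ω i j‖ ^ 2 ∂μ = 1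

/-- Products of at most `m` entries are integrable with integral at most `M`. -/
def EntryProdBounded {Ω : Type*} {n : ℕ} [MeasurableSpace Ω] (μ : Measure Ω)
    (X : Ω → Matrix (Fin n) (Fin n) ℂ) (m : ℕ) (M : ℝ) : Prop :=
  ∀ (E : Type) (q : E → Fin n × Fin n) (s : Finset E), s.card ≤ m →
    Integrable (entryProd X q s) μ ∧ ‖∫ ω, entryProd X q s ω ∂μ‖ ≤ M

/-! ### Cutting a closed path at the step that reverses the first one -/

section Split

variable {j l k : ℕ}

/-- The vertices of a path of length `k + 2` which are those of a path of length `j` starting at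
the vertex `1` and of a path of length `l` ending at the last vertex. -/
def splitVertex (h : j + l = k) : Fin (j + 1) ⊕ Fin (l + 1) → Fin (k + 3) :=
  Sum.elim (fun i => ⟨i + 1, by omega⟩) (fun i => ⟨i + j + 2, by omega⟩)

/-- The steps other than the steps `0` and `j + 1` of a path of length `j + l + 2`. -/
def splitStep (h : j + l = k) : Fin j ⊕ Fin l → Fin (k + 2) :=
  Sum.elim (fun i => ⟨i + 1, by omega⟩) (fun i => ⟨i + j + 2, by omega⟩)

theorem splitStep_injective (h : j + l = k) : Function.Injective (splitStep h) := by
  rintro (a | a) (b | b) hab <;> simp [splitStep, Fin.ext_iff] at hab <;>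
    first | (congr 1; exact Fin.ext hab) | omega

theorem image_splitStep (h : j + l = k) (i : Fin (k + 1)) (hi : (i : ℕ) = j) :
    Finset.univ.image (splitStep h) = Finset.univ \ {0, i.succ} := by
  ext e
  simp only [Finset.mem_image, Finset.mem_univ, true_and, Finset.mem_sdiff, Finset.mem_insert,
    Finset.mem_singleton, not_or]
  constructor
  · rintro ⟨a | a, rfl⟩ <;> (simp [splitStep, Fin.ext_iff]; omega)
  · rintro ⟨h0, h1⟩
    simp only [Fin.ext_iff, Fin.val_zero, Fin.val_succ] at h0 h1
    rcases le_or_gt (e : ℕ) j with hej | hej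
    · exact ⟨Sum.inl ⟨e - 1, by omega⟩, by simp [splitStep, Fin.ext_iff]; omega⟩
    · exact ⟨Sum.inr ⟨e - j - 2, by omega⟩, by simp [splitStep, Fin.ext_iff]; omega⟩

theorem pairStep_comp_splitVertex {n : ℕ} (h : j + l = k) (p : Fin (k + 3) → Fin n)
    (e : Fin j ⊕ Fin l) : pairStep (p ∘ splitVertex h) e = pathStep p (splitStep h e) := by
  rcases e with e | e <;>
    simp only [pairStep, stepOf, pathStep_apply, Function.comp_apply, Sum.map_inl, Sum.map_inr] <;>
    congr 2 <;> simp [splitVertex, splitStep, Fin.ext_iff] <;> omega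

/-- A path of length `k + 2` from two closed paths of lengths `j` and `l`. -/
def gluePaths {n : ℕ} (h : j + l = k) (P : Fin (j + 1) ⊕ Fin (l + 1) → Fin n) :
    Fin (k + 3) → Fin n := fun v =>
  if hv : (v : ℕ) = 0 then P (Sum.inr 0)
  else if hv' : (v : ℕ) ≤ j + 1 then P (Sum.inl ⟨v - 1, by omega⟩)
  else P (Sum.inr ⟨v - j - 2, by omega⟩)

theorem gluePaths_comp_splitVertex {n : ℕ} (h : j + l = k)
    (P : Fin (j + 1) ⊕ Fin (l + 1) → Fin n) : gluePaths h P ∘ splitVertex h = P := by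
  funext x
  rcases x with x | x
  · change gluePaths h P ⟨x + 1, by omega⟩ = _
    simp only [gluePaths]
    rw [dif_neg (by omega), dif_pos (by omega)]
    congr 2
  · change gluePaths h P ⟨x + j + 2, by omega⟩ = _
    simp only [gluePaths]
    rw [dif_neg (by omega), dif_neg (by omega)]
    congr 2
    exact Fin.ext (by simp; omega)

theorem eq_gluePaths {n : ℕ} (h : j + l = k) (p : Fin (k + 3) → Fin n)
    (hp : p 0 = p ⟨j + 2, by omega⟩) : gluePaths h (p ∘ splitVertex h) = p := by
  funext v
  simp only [gluePaths]
  split_ifs with h1 h2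
  · have : v = 0 := Fin.ext h1
    rw [this, hp]
    simp [splitVertex]
  · simp only [Function.comp_apply, splitVertex, Sum.elim_inl]
    congr 1
    exact Fin.ext (by simp; omega)
  · simp only [Function.comp_apply, splitVertex, Sum.elim_inr]
    congr 1
    exact Fin.ext (by simp; omega)

/-- If step `j + 1` reverses step `0`, the path returns to its second vertex after `j` further steps
and to its first vertex one step later. It is thus determined by a closed path of length `j` and one
of length `l`, which are arbitrary. -/
theorem sum_closedPairs_eq_sum_closedPaths {R : Type*} [AddCommMonoid R] {n : ℕ} (h : j + l = k)
    (i : Fin (k + 1)) (hi : (i : ℕ) = j) (f : (Fin (j + 1) ⊕ Fin (l + 1) → Fin n) → R) :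
    ∑ P ∈ closedPairs n j l, f P =
      ∑ p ∈ closedPaths n (k + 2) with pathStep p i.succ = (pathStep p 0).swap,
        f (p ∘ splitVertex h) := by
  have hiff : ∀ p : Fin (k + 3) → Fin n,
      p ∈ (closedPaths n (k + 2)).filter (fun p => pathStep p i.succ = (pathStep p 0).swap) ↔
        p 0 = p ⟨j + 2, by omega⟩ ∧ p ∘ splitVertex h ∈ closedPairs n j l := by
    intro p
    have e1 : (i.succ.castSucc : Fin (k + 3)) = ⟨j + 1, by omega⟩ := Fin.ext (by simp [hi])
    have e2 : (i.succ.succ : Fin (k + 3)) = ⟨j + 2, by omega⟩ := Fin.ext (by simp [hi])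
    have e3 : splitVertex h (Sum.inl 0) = Fin.succ 0 := Fin.ext (by simp [splitVertex])
    have e4 : splitVertex h (Sum.inl (Fin.last j)) = ⟨j + 1, by omega⟩ := rfl
    have e5 : splitVertex h (Sum.inr 0) = ⟨j + 2, by omega⟩ := Fin.ext (by simp [splitVertex])
    have e6 : splitVertex h (Sum.inr (Fin.last l)) = Fin.last (k + 2) :=
      Fin.ext (by simp [splitVertex]; omega)
    simp only [closedPaths, closedPairs, Finset.mem_filter, Finset.mem_univ, true_and,
      pathStep_apply, Prod.swap_prod_mk, Prod.mk.injEq, e1, e2, Function.comp_apply, e3, e4, e5,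
      e6, Fin.castSucc_zero]
    constructor
    · rintro ⟨h1, h2, h3⟩
      exact ⟨h3.symm, h2.symm, h3.trans h1⟩
    · rintro ⟨h1, h2, h3⟩
      exact ⟨h1.trans h3, h2.symm, h1.symm⟩
  refine Finset.sum_nbij' (gluePaths h) (fun p => p ∘ splitVertex h) ?_ ?_ ?_ ?_ ?_
  · intro P hP
    rw [hiff, gluePaths_comp_splitVertex]
    refine ⟨?_, hP⟩
    simp [gluePaths]
  · intro p hp
    exact ((hiff p).1 hp).2
  · intro P _
    exact gluePaths_comp_splitVertex h P
  · intro p hp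
    exact eq_gluePaths h p ((hiff p).1 hp).1
  · intro P _
    rw [gluePaths_comp_splitVertex]

theorem entryProd_pairStep_comp_splitVertex {Ω : Type*} {n : ℕ}
    (X : Ω → Matrix (Fin n) (Fin n) ℂ) (h : j + l = k) (i : Fin (k + 1)) (hi : (i : ℕ) = j)
    (p : Fin (k + 3) → Fin n) (ω : Ω) :
    entryProd X (pairStep (p ∘ splitVertex h)) Finset.univ ω =
      entryProd X (pathStep p) (Finset.univ \ {0, i.succ}) ω := by
  rw [← image_splitStep h i hi, entryProd, entryProd,
    Finset.prod_image (splitStep_injective h).injOn]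
  simp only [pairStep_comp_splitVertex]

end Split

theorem trace_pow_mul_trace_pow {Ω : Type*} {n : ℕ} (X : Ω → Matrix (Fin n) (Fin n) ℂ)
    (j l : ℕ) (ω : Ω) :
    (X ω ^ j).trace * (X ω ^ l).trace =
      ∑ P ∈ closedPairs n j l, entryProd X (pairStep P) Finset.univ ω := by
  rw [trace_pow_eq_sum_entryProd, trace_pow_eq_sum_entryProd, trace_pow_mul_trace_pow_eq_sum]
  exact Finset.sum_congr rfl fun P _ => (entryProd_pairStep X P ω).symm

namespace StandardEntries

variable {Ω : Type*} {n : ℕ} [MeasurableSpace Ω] {μ : Measure Ω}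
  {X : Ω → Matrix (Fin n) (Fin n) ℂ} {r : Setoid (Fin n × Fin n)}

theorem noSingleClass_of_integral_ne_zero (hX : StandardEntries μ X r) {E : Type*} [Fintype E]
    {q : E → Fin n × Fin n} (h : ∫ ω, entryProd X q Finset.univ ω ∂μ ≠ 0) :
    NoSingleClass r q := by
  intro a
  by_contra hcon
  push Not at hcon
  exact h (hX.indep.integral_entryProd_eq_zero hX.meas hX.mean (Finset.mem_univ a)
    fun b _ hb => hcon b hb)

/-- The expected product of the entries along a closed path which is neither bad nor meets few
classes: it is given by the position of the step pairing the first one. -/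
theorem integral_entryProd_eq_sum (hX : StandardEntries μ X r) {k : ℕ} (p : Fin (k + 3) → Fin n)
    (hfew : p ∉ fewClassPaths r (k + 2)) (hbad : p ∉ badPairedPaths r (k + 2)) :
    ∫ ω, entryProd X (pathStep p) Finset.univ ω ∂μ =
      ∑ i : Fin (k + 1), if pathStep p i.succ = (pathStep p 0).swap then
        ∫ ω, entryProd X (pathStep p) (Finset.univ \ {0, i.succ}) ω ∂μ else 0 := by
  classical
  have hswap : ∀ x : Fin n × Fin n, r x.swap x := fun x =>
    hX.indep.rel_swap hX.meas hX.mean hX.herm hX.var x.2 x.1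
  have hnum : k + 2 ≤ 2 * numClasses r (pathStep p) := by
    by_contra h
    exact hfew (Finset.mem_filter.2 ⟨Finset.mem_univ _, not_le.1 h⟩)
  -- When step `0` and its reversal form a full class along the path, that pair splits off by
  -- independence with expectation `1`. In the remaining case both sides vanish.
  by_cases hgood : ∃ i : Fin (k + 1), pathStep p i.succ = (pathStep p 0).swap ∧
      ∀ e, e ≠ 0 → e ≠ i.succ → ¬ r (pathStep p 0) (pathStep p e)
  · obtain ⟨i, hi, hsep⟩ := hgood
    rw [Finset.sum_eq_single i]
    · rw [if_pos hi]
      have hsplit : ∀ ω, entryProd X (pathStep p) Finset.univ ω =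
          entryProd X (pathStep p) {0, i.succ} ω *
            entryProd X (pathStep p) (Finset.univ \ {0, i.succ}) ω := by
        intro ω
        rw [mul_comm]
        exact (Finset.prod_sdiff (Finset.subset_univ _)).symm
      simp_rw [hsplit]
      rw [hX.indep.integral_entryProd_mul hX.meas]
      · have h1 : ∫ ω, entryProd X (pathStep p) {0, i.succ} ω ∂μ = 1 := by
          simp_rw [entryProd, Finset.prod_pair (Fin.succ_ne_zero i).symm, hi, Prod.fst_swap,
            Prod.snd_swap]
          exact integral_mul_swap_eq_one hX.herm hX.var _ _
        rw [h1, one_mul]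
      · intro a ha b hb hab
        simp only [Finset.mem_sdiff, Finset.mem_univ, true_and, Finset.mem_insert,
          Finset.mem_singleton, not_or] at ha hb
        refine hsep b hb.1 hb.2 ?_
        rcases ha with rfl | rfl
        · exact hab
        · rw [hi] at hab
          exact r.trans (r.symm (hswap _)) hab
    · intro i' _ hne
      rw [if_neg]
      intro hi'
      refine hsep i'.succ (Fin.succ_ne_zero _) (fun h => hne (Fin.succ_injective _ h)) ?_
      rw [hi']
      exact r.symm (hswap _)
    · simp
  · have hzero : ∫ ω, entryProd X (pathStep p) Finset.univ ω ∂μ = 0 := by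
      by_contra hne
      have hns := hX.noSingleClass_of_integral_ne_zero hne
      have hle := hns.two_mul_numClasses_le
      rw [Fintype.card_fin] at hle
      obtain ⟨b, hb, hrb⟩ := hns 0
      obtain ⟨i, rfl⟩ := Fin.exists_succ_eq.2 hb
      have hi : pathStep p i.succ = (pathStep p 0).swap := by
        by_contra h
        exact hbad (Finset.mem_filter.2 ⟨Finset.mem_univ _, hns, le_antisymm hle hnum,
          i.succ, 0, hb, hrb, h⟩)
      refine hgood ⟨i, hi, fun e he0 hei hre => ?_⟩
      have := hns.two_mul_numClasses_lt hb.symm he0.symm hei.symm hrb (r.symm hre)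
      rw [Fintype.card_fin] at this
      omega
    rw [hzero]
    refine (Finset.sum_eq_zero fun i _ => ?_).symm
    split_ifs with hi
    · by_contra hne
      push Not at hgood
      obtain ⟨e, he0, hei, hre⟩ := hgood i hi
      -- A nonzero term would leave `k` steps without single classes, hence at most `k / 2` classes.
      -- But the third step `e` in the class of step `0` keeps that class represented, so all
      -- classes, at least `(k + 2) / 2` of them, are still met.
      have hpair : ∀ a ∈ Finset.univ \ {0, i.succ}, ∃ b ∈ Finset.univ \ {0, i.succ}, b ≠ a ∧
          classPattern r (pathStep p) b = classPattern r (pathStep p) a := by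
        intro a ha
        by_contra hcon
        push Not at hcon
        exact hne (hX.indep.integral_entryProd_eq_zero hX.meas hX.mean ha
          fun b hb hba hr => hcon b hb hba (classPattern_eq_iff.2 hr))
      have h1 := Finset.two_mul_card_image_le hpair
      rw [Finset.card_sdiff_of_subset (Finset.subset_univ _), Finset.card_univ, Fintype.card_fin,
        Finset.card_pair (Fin.succ_ne_zero i).symm] at h1
      have h2 : Finset.univ.image (classPattern r (pathStep p)) ⊆
          (Finset.univ \ {0, i.succ}).image (classPattern r (pathStep p)) := by
        intro x hx
        obtain ⟨a, -, rfl⟩ := Finset.mem_image.1 hx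
        have he : e ∈ Finset.univ \ {0, i.succ} := by simp [he0, hei]
        by_cases ha : a ∈ Finset.univ \ {0, i.succ}
        · exact Finset.mem_image_of_mem _ ha
        · refine Finset.mem_image.2 ⟨e, he, classPattern_eq_iff.2 ?_⟩
          simp only [Finset.mem_sdiff, Finset.mem_univ, true_and, Finset.mem_insert,
            Finset.mem_singleton, not_not] at ha
          rcases ha with rfl | rfl
          · exact r.symm hre
          · rw [hi]
            exact r.trans (r.symm hre) (r.symm (hswap _))
      have h3 := Finset.card_le_card h2
      rw [numClasses_eq_card] at hnum
      omega
    · rfl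

theorem integral_trace_pow (k : ℕ) {M : ℝ} (hM : EntryProdBounded μ X k M) :
    ∫ ω, (X ω ^ k).trace ∂μ =
      ∑ p ∈ closedPaths n k, ∫ ω, entryProd X (pathStep p) Finset.univ ω ∂μ := by
  simp_rw [trace_pow_eq_sum_entryProd]
  exact integral_finsetSum _ fun p _ => (hM _ _ _ (by simp)).1

theorem integral_trace_pow_mul_trace_pow (j l : ℕ) {M : ℝ}
    (hM : EntryProdBounded μ X (j + l) M) :
    ∫ ω, (X ω ^ j).trace * (X ω ^ l).trace ∂μ =
      ∑ P ∈ closedPairs n j l, ∫ ω, entryProd X (pairStep P) Finset.univ ω ∂μ := by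
  simp_rw [trace_pow_mul_trace_pow]
  exact integral_finsetSum _ fun p _ => (hM _ _ _ (by simp)).1

/-- The recursion for the expected traces, up to the number of exceptional paths. -/
theorem norm_integral_trace_pow_sub_le (hX : StandardEntries μ X r) (k : ℕ) {M : ℝ}
    (hM : EntryProdBounded μ X (k + 2) M) :
    ‖∫ ω, (X ω ^ (k + 2)).trace ∂μ -
        ∑ i : Fin (k + 1), ∫ ω, (X ω ^ (i : ℕ)).trace * (X ω ^ (k - i)).trace ∂μ‖ ≤
      (k + 2) * M * ((fewClassPaths r (k + 2)).card + (badPairedPaths r (k + 2)).card) := by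
  classical
  have hM0 : 0 ≤ M := (norm_nonneg _).trans
    (hM Empty (fun e => e.elim) ∅ (by simp)).2
  have hpairs : ∀ i : Fin (k + 1),
      ∫ ω, (X ω ^ (i : ℕ)).trace * (X ω ^ (k - i)).trace ∂μ =
        ∑ p ∈ closedPaths n (k + 2), if pathStep p i.succ = (pathStep p 0).swap then
          ∫ ω, entryProd X (pathStep p) (Finset.univ \ {0, i.succ}) ω ∂μ else 0 := by
    intro i
    have h : (i : ℕ) + (k - i) = k := by omega
    rw [integral_trace_pow_mul_trace_pow (i : ℕ) (k - i)
      (fun E q s hs => hM E q s (by omega) : EntryProdBounded μ X _ M),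
      sum_closedPairs_eq_sum_closedPaths h i rfl, Finset.sum_filter]
    simp_rw [entryProd_pairStep_comp_splitVertex X h i rfl]
  rw [integral_trace_pow _ hM]
  simp_rw [hpairs]
  rw [Finset.sum_comm, ← Finset.sum_sub_distrib]
  set τ : (Fin (k + 3) → Fin n) → ℂ := fun p =>
    ∫ ω, entryProd X (pathStep p) Finset.univ ω ∂μ -
      ∑ i : Fin (k + 1), if pathStep p i.succ = (pathStep p 0).swap then
        ∫ ω, entryProd X (pathStep p) (Finset.univ \ {0, i.succ}) ω ∂μ else 0 with hτ
  have hτ0 : ∀ p, p ∉ fewClassPaths r (k + 2) ∪ badPairedPaths r (k + 2) → τ p = 0 := by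
    intro p hp
    rw [Finset.mem_union, not_or] at hp
    exact sub_eq_zero.2 (hX.integral_entryProd_eq_sum p hp.1 hp.2)
  have hτM : ∀ p, ‖τ p‖ ≤ (k + 2) * M := by
    intro p
    refine (norm_sub_le _ _).trans ?_
    have h1 : ‖∫ ω, entryProd X (pathStep p) Finset.univ ω ∂μ‖ ≤ M := (hM _ _ _ (by simp)).2
    have h2 : ‖∑ i : Fin (k + 1), if pathStep p i.succ = (pathStep p 0).swap then
        ∫ ω, entryProd X (pathStep p) (Finset.univ \ {0, i.succ}) ω ∂μ else 0‖ ≤ (k + 1) * M := by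
      refine (norm_sum_le_of_le (f := _) (n := fun _ => M) _ fun i _ => ?_).trans (by simp)
      split_ifs
      · exact (hM _ _ _ ((Finset.card_le_univ _).trans (by simp))).2
      · simpa using hM0
    linarith
  calc ‖∑ p ∈ closedPaths n (k + 2), τ p‖
      ≤ ∑ p ∈ closedPaths n (k + 2), ‖τ p‖ := norm_sum_le _ _
    _ ≤ ∑ p ∈ Finset.univ, ‖τ p‖ :=
      Finset.sum_le_sum_of_subset_of_nonneg (Finset.subset_univ _) fun _ _ _ => norm_nonneg _
    _ = ∑ p ∈ fewClassPaths r (k + 2) ∪ badPairedPaths r (k + 2), ‖τ p‖ := by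
      refine (Finset.sum_subset (Finset.subset_univ _) fun p _ hp => ?_).symm
      rw [hτ0 p hp, norm_zero]
    _ ≤ (fewClassPaths r (k + 2) ∪ badPairedPaths r (k + 2)).card * ((k + 2) * M) := by
      rw [← nsmul_eq_mul]
      exact Finset.sum_le_card_nsmul _ _ _ fun p _ => hτM p
    _ ≤ ((fewClassPaths r (k + 2)).card + (badPairedPaths r (k + 2)).card) * ((k + 2) * M) := by
      gcongr
      exact_mod_cast Finset.card_union_le _ _
    _ = _ := by ring

/-- The covariance of two traces is bounded by the number of linked pairs of loops. -/
theorem norm_covariance_trace_le (hX : StandardEntries μ X r) (j l : ℕ) {M : ℝ}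
    (hM : EntryProdBounded μ X (j + l) M) :
    ‖∫ ω, (X ω ^ j).trace * (X ω ^ l).trace ∂μ -
        (∫ ω, (X ω ^ j).trace ∂μ) * ∫ ω, (X ω ^ l).trace ∂μ‖ ≤
      (M + M ^ 2) * (linkedLoops r j l).card := by
  classical
  have hM0 : 0 ≤ M := (norm_nonneg _).trans
    (hM Empty (fun e => e.elim) ∅ (by simp)).2
  have hMj : EntryProdBounded μ X j M := fun E q s hs => hM E q s (by omega)
  have hMl : EntryProdBounded μ X l M := fun E q s hs => hM E q s (by omega)
  rw [integral_trace_pow_mul_trace_pow j l hM, integral_trace_pow j hMj, integral_trace_pow l hMl,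
    trace_pow_mul_trace_pow_eq_sum, ← Finset.sum_sub_distrib]
  set τ : (Fin (j + 1) ⊕ Fin (l + 1) → Fin n) → ℂ := fun P =>
    ∫ ω, entryProd X (pairStep P) Finset.univ ω ∂μ -
      (∫ ω, entryProd X (pathStep (P ∘ Sum.inl)) Finset.univ ω ∂μ) *
        ∫ ω, entryProd X (pathStep (P ∘ Sum.inr)) Finset.univ ω ∂μ with hτ
  -- Without a common class the expectation factors. With a common class, a pair outside
  -- `linkedLoops` has a single class, and this kills both the joint expectation and the product of
  -- the two expectations.
  have hτ0 : ∀ P ∈ closedPairs n j l, P ∉ linkedLoops r j l → τ P = 0 := by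
    intro P hP hPl
    have hshared : (∃ a b, r (pairStep P (Sum.inl a)) (pairStep P (Sum.inr b))) →
        ¬ NoSingleClass r (pairStep P) := fun h h' =>
      hPl (Finset.mem_filter.2 ⟨Finset.mem_univ _, (Finset.mem_filter.1 hP).2.1, h', h⟩)
    by_cases h : ∃ a b, r (pairStep P (Sum.inl a)) (pairStep P (Sum.inr b))
    · have hns := hshared h
      have h1 : ∫ ω, entryProd X (pairStep P) Finset.univ ω ∂μ = 0 := by
        by_contra hne
        exact hns (hX.noSingleClass_of_integral_ne_zero hne)
      have h2 : (∫ ω, entryProd X (pathStep (P ∘ Sum.inl)) Finset.univ ω ∂μ) *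
          ∫ ω, entryProd X (pathStep (P ∘ Sum.inr)) Finset.univ ω ∂μ = 0 := by
        by_contra hne
        have hl := hX.noSingleClass_of_integral_ne_zero (left_ne_zero_of_mul hne)
        have hr := hX.noSingleClass_of_integral_ne_zero (right_ne_zero_of_mul hne)
        refine hns ?_
        rintro (a | a)
        · obtain ⟨b, hb, hrb⟩ := hl a
          exact ⟨Sum.inl b, by simpa using hb, hrb⟩
        · obtain ⟨b, hb, hrb⟩ := hr a
          exact ⟨Sum.inr b, by simpa using hb, hrb⟩
      rw [hτ]
      simp only [h1, h2, sub_zero]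
    · push Not at h
      rw [hτ]
      simp_rw [entryProd_pairStep]
      rw [hX.indep.integral_entryProd_mul hX.meas, sub_self]
      intro a _ b _
      exact h a b
  have hτM : ∀ P, ‖τ P‖ ≤ M + M ^ 2 := by
    intro P
    refine (norm_sub_le _ _).trans (add_le_add (hM _ _ _ (by simp)).2 ?_)
    rw [norm_mul, sq]
    exact mul_le_mul (hMj _ _ _ (by simp)).2 (hMl _ _ _ (by simp)).2 (norm_nonneg _) hM0
  calc ‖∑ P ∈ closedPairs n j l, τ P‖
      ≤ ∑ P ∈ closedPairs n j l, ‖τ P‖ := norm_sum_le _ _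
    _ = ∑ P ∈ closedPairs n j l with P ∈ linkedLoops r j l, ‖τ P‖ := by
      rw [Finset.sum_filter]
      refine Finset.sum_congr rfl fun P hP => ?_
      split_ifs with h
      · rfl
      · rw [hτ0 P hP h, norm_zero]
    _ ≤ ∑ P ∈ linkedLoops r j l, ‖τ P‖ :=
      Finset.sum_le_sum_of_subset_of_nonneg (fun P hP => (Finset.mem_filter.1 hP).2)
        fun _ _ _ => norm_nonneg _
    _ ≤ (linkedLoops r j l).card * (M + M ^ 2) := by
      rw [← nsmul_eq_mul]
      exact Finset.sum_le_card_nsmul _ _ _ fun p _ => hτM p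
    _ = _ := by ring

end StandardEntries

/-! ### The moments of the semicircle law -/

/-- The moments of the semicircle law: the Catalan numbers in even degrees, zero in odd degrees. -/
def semicircleMoment (k : ℕ) : ℝ := if Even k then (catalan (k / 2) : ℝ) else 0

theorem semicircleMoment_two_mul (m : ℕ) : semicircleMoment (2 * m) = catalan m := by
  simp [semicircleMoment]

theorem semicircleMoment_of_odd {k : ℕ} (hk : Odd k) : semicircleMoment k = 0 := by
  simp [semicircleMoment, Nat.not_even_iff_odd.2 hk]

theorem Finset.sum_range_two_mul_add_one_of_odd_eq_zero {R : Type*} [AddCommMonoid R] (f : ℕ → R)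
    (hf : ∀ k, Odd k → f k = 0) (m : ℕ) :
    ∑ i ∈ Finset.range (2 * m + 1), f i = ∑ a ∈ Finset.range (m + 1), f (2 * a) := by
  induction m with
  | zero => simp
  | succ m ih =>
    rw [show 2 * (m + 1) + 1 = (2 * m + 1) + 1 + 1 by ring, Finset.sum_range_succ,
      Finset.sum_range_succ, ih, hf (2 * m + 1) ⟨m, rfl⟩, add_zero, Finset.sum_range_succ _ (m + 1)]
    rfl

theorem semicircleMoment_add_two (k : ℕ) :
    semicircleMoment (k + 2) = ∑ i : Fin (k + 1), semicircleMoment i * semicircleMoment (k - i) := by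
  rw [Fin.sum_univ_eq_sum_range fun i => semicircleMoment i * semicircleMoment (k - i)]
  rcases Nat.even_or_odd' k with ⟨m, rfl | rfl⟩
  · rw [Finset.sum_range_two_mul_add_one_of_odd_eq_zero
      (fun i => semicircleMoment i * semicircleMoment (2 * m - i))
      (fun i hi => by simp only [semicircleMoment_of_odd hi, zero_mul]),
      show 2 * m + 2 = 2 * (m + 1) by ring, semicircleMoment_two_mul, catalan_succ,
      Fin.sum_univ_eq_sum_range fun i => catalan i * catalan (m - i)]
    push_cast
    refine Finset.sum_congr rfl fun a _ => ?_
    rw [← Nat.mul_sub, semicircleMoment_two_mul, semicircleMoment_two_mul]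
  · rw [semicircleMoment_of_odd ⟨m + 1, by ring⟩]
    refine (Finset.sum_eq_zero fun i hi => ?_).symm
    rcases Nat.even_or_odd i with he | ho
    · have : Odd (2 * m + 1 - i) :=
        Nat.Odd.sub_even (Nat.lt_succ_iff.1 (Finset.mem_range.1 hi)) ⟨m, rfl⟩ he
      rw [semicircleMoment_of_odd this, mul_zero]
    · rw [semicircleMoment_of_odd ho, zero_mul]

/-- The ratio of consecutive Catalan numbers, read off from central binomial coefficients; it is the
form that matches the reduction formula for integrals of powers of the cosine. -/
theorem semicircleMoment_add_two_eq_mul (k : ℕ) :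
    semicircleMoment (k + 2) = semicircleMoment k * (4 * (k + 1) / (k + 4)) := by
  rcases Nat.even_or_odd' k with ⟨m, rfl | rfl⟩
  · rw [show 2 * m + 2 = 2 * (m + 1) by ring, semicircleMoment_two_mul, semicircleMoment_two_mul]
    have h1 : ((m + 1 : ℕ) + 1 : ℝ) * catalan (m + 1) = (m + 1).centralBinom := by
      exact_mod_cast succ_mul_catalan_eq_centralBinom (m + 1)
    have h2 : ((m : ℝ) + 1) * catalan m = m.centralBinom := by
      exact_mod_cast succ_mul_catalan_eq_centralBinom m
    have h3 : ((m : ℝ) + 1) * (m + 1).centralBinom = 2 * (2 * m + 1) * m.centralBinom := by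
      exact_mod_cast Nat.succ_mul_centralBinom_succ m
    rw [← h1, ← h2] at h3
    have hm : (m : ℝ) + 1 ≠ 0 := by positivity
    push_cast at h3 ⊢
    have h4 : ((m : ℝ) + 2) * catalan (m + 1) = 2 * (2 * m + 1) * catalan m :=
      mul_left_cancel₀ hm (by linear_combination h3)
    field_simp
    linear_combination 2 * h4
  · rw [semicircleMoment_of_odd ⟨m + 1, by ring⟩, semicircleMoment_of_odd ⟨m, rfl⟩, zero_mul]

theorem integral_cos_pow_eq_semicircleMoment (k : ℕ) :
    2 ^ (k + 2) * (∫ θ in (0 : ℝ)..Real.pi, Real.cos θ ^ k) =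
      2 * Real.pi * (k + 2) * semicircleMoment k := by
  induction k using Nat.twoStepInduction with
  | zero =>
    simp [semicircleMoment]
    ring
  | one => simp [semicircleMoment]
  | more k ih _ =>
    rw [integral_cos_pow, semicircleMoment_add_two_eq_mul]
    simp only [Real.sin_pi, Real.sin_zero, mul_zero, sub_zero, zero_div, zero_add]
    have h4 : (k : ℝ) + 4 ≠ 0 := by positivity
    have h2 : (k : ℝ) + 2 ≠ 0 := by positivity
    have : (2 : ℝ) ^ (k + 2 + 2) * ((k + 1) / (k + 2) * ∫ θ in (0 : ℝ)..Real.pi, Real.cos θ ^ k) =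
        4 * ((k + 1) / (k + 2)) * (2 ^ (k + 2) * ∫ θ in (0 : ℝ)..Real.pi, Real.cos θ ^ k) := by
      ring
    rw [this, ih]
    push_cast
    field_simp
    ring

/-- The substitution `x = 2 * cos θ` turns the integral into a difference of two integrals of powers
of the cosine. -/
theorem integral_pow_mul_sqrt_four_sub_sq (k : ℕ) :
    ∫ x in (-2 : ℝ)..2, x ^ k * √(4 - x ^ 2) = 2 * Real.pi * semicircleMoment k := by
  have h1 := intervalIntegral.integral_comp_mul_deriv (a := 0) (b := Real.pi)
    (f := fun θ => 2 * Real.cos θ) (f' := fun θ => -(2 * Real.sin θ))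
    (g := fun x => x ^ k * √(4 - x ^ 2))
    (fun θ _ => by simpa using (Real.hasDerivAt_cos θ).const_mul 2)
    (by fun_prop) (by fun_prop)
  simp only [Real.cos_zero, Real.cos_pi, Function.comp_apply, mul_one, mul_neg] at h1
  rw [intervalIntegral.integral_symm, ← h1, ← intervalIntegral.integral_neg]
  have h2 : ∀ θ ∈ Set.uIcc 0 Real.pi,
      -(-((2 * Real.cos θ) ^ k * √(4 - (2 * Real.cos θ) ^ 2) * (2 * Real.sin θ))) =
        2 ^ (k + 2) * (Real.cos θ ^ k - Real.cos θ ^ (k + 2)) := by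
    intro θ hθ
    rw [Set.uIcc_of_le Real.pi_pos.le] at hθ
    have hs : √(4 - (2 * Real.cos θ) ^ 2) = 2 * Real.sin θ := by
      rw [show 4 - (2 * Real.cos θ) ^ 2 = (2 * Real.sin θ) ^ 2 by
        nlinarith [Real.sin_sq_add_cos_sq θ]]
      exact Real.sqrt_sq (by have := Real.sin_nonneg_of_mem_Icc hθ; positivity)
    rw [hs]
    have := Real.sin_sq_add_cos_sq θ
    calc _ = 2 ^ (k + 2) * Real.cos θ ^ k * Real.sin θ ^ 2 := by ring
      _ = _ := by
        rw [show Real.sin θ ^ 2 = 1 - Real.cos θ ^ 2 by linarith]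
        ring
  rw [intervalIntegral.integral_congr h2, intervalIntegral.integral_const_mul,
    intervalIntegral.integral_sub (Continuous.intervalIntegrable (by fun_prop) _ _)
      (Continuous.intervalIntegrable (by fun_prop) _ _), integral_cos_pow]
  simp only [Real.sin_pi, Real.sin_zero, mul_zero, sub_zero, zero_div, zero_add]
  have h3 := integral_cos_pow_eq_semicircleMoment k
  have h4 : (k : ℝ) + 2 ≠ 0 := by positivity
  field_simp
  linear_combination h3

theorem semicircleDensity_nonneg (x : ℝ) : 0 ≤ semicircleDensity x :=
  Set.indicator_nonneg (fun _ _ => by positivity) x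

theorem measurable_semicircleDensity : Measurable semicircleDensity := by
  unfold semicircleDensity
  exact Measurable.indicator (by fun_prop) measurableSet_Icc

theorem integral_semicircleMeasure (g : ℝ → ℝ) :
    ∫ x, g x ∂semicircleMeasure =
      ∫ x in (-2 : ℝ)..2, 1 / (2 * Real.pi) * √(4 - x ^ 2) * g x := by
  rw [semicircleMeasure, integral_withDensity_eq_integral_toReal_smul
    measurable_semicircleDensity.ennreal_ofReal (by simp),
    intervalIntegral.integral_of_le (by norm_num), ← integral_Icc_eq_integral_Ioc,
    ← integral_indicator measurableSet_Icc]
  refine integral_congr_ae (Eventually.of_forall fun x => ?_)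
  simp only [ENNReal.toReal_ofReal (semicircleDensity_nonneg x), smul_eq_mul]
  by_cases hx : x ∈ Set.Icc (-2 : ℝ) 2 <;> simp [semicircleDensity, hx]

theorem integral_pow_semicircleMeasure (k : ℕ) :
    ∫ x, x ^ k ∂semicircleMeasure = semicircleMoment k := by
  rw [integral_semicircleMeasure]
  have : ∀ x : ℝ, 1 / (2 * Real.pi) * √(4 - x ^ 2) * x ^ k =
      1 / (2 * Real.pi) * (x ^ k * √(4 - x ^ 2)) := fun x => by ring
  simp_rw [this]
  rw [intervalIntegral.integral_const_mul, integral_pow_mul_sqrt_four_sub_sq]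
  field_simp

theorem ae_abs_le_two_semicircleMeasure : ∀ᵐ x ∂semicircleMeasure, |x| ≤ 2 := by
  rw [semicircleMeasure, ae_withDensity_iff measurable_semicircleDensity.ennreal_ofReal]
  refine Eventually.of_forall fun x hx => ?_
  by_contra h
  apply hx
  have : x ∉ Set.Icc (-2 : ℝ) 2 := fun h' => h (abs_le.2 h')
  simp [semicircleDensity, this]

theorem integrable_pow_semicircleMeasure (k : ℕ) :
    Integrable (fun x : ℝ => x ^ k) semicircleMeasure := by
  have := isProbabilityMeasure_semicircle
  refine Integrable.of_bound (by fun_prop) (2 ^ k) ?_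
  filter_upwards [ae_abs_le_two_semicircleMeasure] with x hx
  rw [norm_pow, Real.norm_eq_abs]
  gcongr

/-! ### The method of moments -/

theorem Polynomial.integrable_eval_of_integrable_pow {ν : Measure ℝ}
    (hν : ∀ k : ℕ, Integrable (fun x : ℝ => x ^ k) ν) (p : Polynomial ℝ) :
    Integrable (fun x => p.eval x) ν := by
  simp_rw [Polynomial.eval_eq_sum_range]
  exact integrable_finsetSum _ fun k _ => (hν k).const_mul _

theorem Polynomial.integral_eval_eq_sum {ν : Measure ℝ}
    (hν : ∀ k : ℕ, Integrable (fun x : ℝ => x ^ k) ν) (p : Polynomial ℝ) :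
    ∫ x, p.eval x ∂ν = ∑ k ∈ Finset.range (p.natDegree + 1), p.coeff k * ∫ x, x ^ k ∂ν := by
  simp_rw [Polynomial.eval_eq_sum_range]
  rw [integral_finsetSum _ fun k _ => (hν k).const_mul _]
  simp_rw [integral_const_mul]

/-- The constant does not depend on `m`, so `m` can later be taken large to make the tail bound
small on the support of the semicircle law. -/
theorem Polynomial.exists_abs_eval_le (p : Polynomial ℝ) :
    ∃ C : ℝ, 0 ≤ C ∧ ∀ m : ℕ, p.natDegree ≤ 2 * m → ∀ x : ℝ, 3 ≤ |x| →
      |p.eval x| ≤ C * (x / 3) ^ (2 * m) := by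
  refine ⟨∑ k ∈ Finset.range (p.natDegree + 1), |p.coeff k| * 3 ^ k, by positivity, ?_⟩
  intro m hm x hx
  rw [Polynomial.eval_eq_sum_range, Finset.sum_mul]
  refine (Finset.abs_sum_le_sum_abs _ _).trans (Finset.sum_le_sum fun k hk => ?_)
  have h1 : 1 ≤ |x / 3| := by
    rw [abs_div, abs_of_pos (three_pos : (0 : ℝ) < 3)]
    linarith
  rw [abs_mul, mul_assoc]
  refine mul_le_mul_of_nonneg_left ?_ (abs_nonneg _)
  calc |x ^ k| = 3 ^ k * |x / 3| ^ k := by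
        rw [← mul_pow, abs_div, abs_of_pos (three_pos : (0 : ℝ) < 3), abs_pow]
        congr 1
        ring
    _ ≤ 3 ^ k * |x / 3| ^ (2 * m) := by
      gcongr
      · exact (Nat.lt_succ_iff.1 (Finset.mem_range.1 hk)).trans hm
    _ = _ := by rw [(even_two_mul m).pow_abs]

/-- Convergence of all moments to those of the semicircle law implies weak convergence. -/
theorem tendsto_semicircleLaw_of_tendsto_moments {ν : ℕ → ProbabilityMeasure ℝ}
    (hν : ∀ j k, Integrable (fun x : ℝ => x ^ k) (ν j : Measure ℝ))
    (hlim : ∀ k, Tendsto (fun j => ∫ x, x ^ k ∂(ν j : Measure ℝ)) atTop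
      (𝓝 (semicircleMoment k))) : Tendsto ν atTop (𝓝 semicircleLaw) := by
  have hprob := isProbabilityMeasure_semicircle
  have hpoly : ∀ p : Polynomial ℝ, Tendsto (fun j => ∫ x, p.eval x ∂(ν j : Measure ℝ)) atTop
      (𝓝 (∫ x, p.eval x ∂semicircleMeasure)) := by
    intro p
    simp_rw [fun j => p.integral_eval_eq_sum (hν j),
      p.integral_eval_eq_sum integrable_pow_semicircleMeasure, integral_pow_semicircleMeasure]
    exact tendsto_finsetSum _ fun k _ => (hlim k).const_mul _
  rw [ProbabilityMeasure.tendsto_iff_forall_integral_tendsto]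
  intro f
  change Tendsto _ _ (𝓝 (∫ x, f x ∂semicircleMeasure))
  rw [Metric.tendsto_atTop]
  intro ε hε
  obtain ⟨p, hp⟩ := exists_polynomial_near_of_continuousOn (-3) 3 f f.continuous.continuousOn
    (ε / 6) (by positivity)
  obtain ⟨C, hC0, hC⟩ := p.exists_abs_eval_le
  have hgeom : Tendsto (fun m : ℕ => (‖f‖ + C) * (4 / 9 : ℝ) ^ m) atTop (𝓝 0) := by
    simpa using (tendsto_pow_atTop_nhds_zero_of_lt_one (by norm_num : (0 : ℝ) ≤ 4 / 9)
      (by norm_num)).const_mul (‖f‖ + C)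
  obtain ⟨m, hm, hmdeg⟩ := ((hgeom.eventually_lt_const (by positivity : 0 < ε / 6)).and
    (eventually_ge_atTop p.natDegree)).exists
  -- A polynomial majorant of `|f - p|`: the constant serves on `[-3, 3]`, the even power outside.
  -- On `[-2, 2]` the even power is at most `(4 / 9) ^ m`, so the integral of `q` against the
  -- semicircle law is at most `ε / 3`.
  set q : Polynomial ℝ := Polynomial.C (ε / 6) +
    Polynomial.C ((‖f‖ + C) * (1 / 3) ^ (2 * m)) * Polynomial.X ^ (2 * m) with hq
  have hqeval : ∀ x, q.eval x = ε / 6 + (‖f‖ + C) * (x / 3) ^ (2 * m) := by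
    intro x
    simp [hq, div_eq_mul_inv, mul_pow]
    ring
  have hfp : ∀ x, |f x - p.eval x| ≤ q.eval x := by
    intro x
    rw [hqeval]
    have hnonneg : 0 ≤ (x / 3) ^ (2 * m) := (even_two_mul m).pow_nonneg _
    rcases le_or_gt |x| 3 with hx | hx
    · have := (hp x (abs_le.1 hx)).le
      rw [abs_sub_comm] at this
      have h2 : 0 ≤ (‖f‖ + C) * (x / 3) ^ (2 * m) := by positivity
      linarith
    · have h1 := hC m (by omega) x hx.le
      have h2 : |f x| ≤ ‖f‖ := f.norm_coe_le_norm x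
      have h3 : 1 ≤ (x / 3) ^ (2 * m) := by
        rw [← (even_two_mul m).pow_abs]
        refine one_le_pow₀ ?_
        rw [abs_div, abs_of_pos (three_pos : (0 : ℝ) < 3)]
        linarith
      have h4 : ‖f‖ ≤ ‖f‖ * (x / 3) ^ (2 * m) := le_mul_of_one_le_right (norm_nonneg _) h3
      calc |f x - p.eval x| ≤ |f x| + |p.eval x| := abs_sub _ _
        _ ≤ _ := by linarith
  have hdiff : ∀ ρ : Measure ℝ, IsProbabilityMeasure ρ →
      (∀ k : ℕ, Integrable (fun x : ℝ => x ^ k) ρ) →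
      |∫ x, f x ∂ρ - ∫ x, p.eval x ∂ρ| ≤ ∫ x, q.eval x ∂ρ := by
    intro ρ _ hρ
    rw [← integral_sub (f.integrable ρ) (p.integrable_eval_of_integrable_pow hρ)]
    refine (abs_integral_le_integral_abs).trans (integral_mono
      ((f.integrable ρ).sub (p.integrable_eval_of_integrable_pow hρ)).abs
      (q.integrable_eval_of_integrable_pow hρ) hfp)
  have hqσ : ∫ x, q.eval x ∂semicircleMeasure ≤ ε / 3 := by
    have hle : ∀ᵐ x ∂semicircleMeasure, q.eval x ≤ ε / 3 := by
      filter_upwards [ae_abs_le_two_semicircleMeasure] with x hx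
      rw [hqeval]
      have h1 : (x / 3) ^ (2 * m) ≤ (4 / 9) ^ m := by
        rw [pow_mul]
        refine pow_le_pow_left₀ (sq_nonneg _) ?_ m
        have := abs_le.1 hx
        nlinarith
      have h2 : (‖f‖ + C) * (x / 3) ^ (2 * m) ≤ (‖f‖ + C) * (4 / 9) ^ m := by gcongr
      linarith
    refine (integral_mono_ae (q.integrable_eval_of_integrable_pow integrable_pow_semicircleMeasure)
      (integrable_const _) hle).trans ?_
    simp
  -- The final error is less than `(5 / 12 + 1 / 6 + 1 / 3) * ε`, which is below `ε`.
  have h1 := (hpoly q).eventually_lt_const (lt_of_le_of_lt hqσ (by linarith : ε / 3 < ε * (5 / 12)))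
  have h2 := (Metric.tendsto_nhds.1 (hpoly p)) (ε / 6) (by positivity)
  obtain ⟨N, hN⟩ := eventually_atTop.1 (h1.and h2)
  refine ⟨N, fun j hj => ?_⟩
  obtain ⟨hj1, hj2⟩ := hN j hj
  have h3 := hdiff (ν j) inferInstance (hν j)
  have h4 := hdiff semicircleMeasure hprob integrable_pow_semicircleMeasure
  rw [Real.dist_eq] at hj2 ⊢
  rw [abs_le] at h3 h4
  rw [abs_lt] at hj2 ⊢
  constructor <;> linarith [h3.1, h3.2, h4.1, h4.2, hj2.1, hj2.2]

/-- For a metric of weak convergence, a measure is near the semicircle law as soon as finitely many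
of its moments are near those of the semicircle law. -/
theorem MetrizesWeakConvergence.exists_moments_near
    {d : ProbabilityMeasure ℝ → ProbabilityMeasure ℝ → ℝ} (hd : MetrizesWeakConvergence d) {ε : ℝ}
    (hε : 0 < ε) : ∃ K : ℕ, ∃ δ : ℝ, 0 < δ ∧ ∀ ν : ProbabilityMeasure ℝ,
      (∀ k : ℕ, Integrable (fun x : ℝ => x ^ k) (ν : Measure ℝ)) →
      (∀ k < K, |∫ x, x ^ k ∂(ν : Measure ℝ) - semicircleMoment k| < δ) →
      d ν semicircleLaw ≤ ε := by
  by_contra! hcon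
  -- A counterexample for `K = j` and `δ = 1 / (j + 1)` for each `j` gives a sequence all of whose
  -- moments converge while `d` stays above `ε`.
  choose ν hν1 hν2 hν3 using fun j : ℕ =>
    hcon j (1 / ((j : ℝ) + 1)) (by positivity)
  have hlim : Tendsto ν atTop (𝓝 semicircleLaw) := by
    refine tendsto_semicircleLaw_of_tendsto_moments hν1 fun k => ?_
    rw [tendsto_iff_dist_tendsto_zero]
    refine squeeze_zero' (Eventually.of_forall fun _ => dist_nonneg) ?_
      tendsto_one_div_add_atTop_nhds_zero_nat
    filter_upwards [eventually_gt_atTop k] with j hj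
    rw [Real.dist_eq]
    exact (hν2 j k hj).le
  have := ((hd.tendsto_iff ν semicircleLaw).1 hlim).eventually_lt_const hε
  obtain ⟨j, hj⟩ := this.exists
  exact absurd (hν3 j) (not_lt.2 hj.le)

/-! ### The moments of the empirical spectral distribution -/

theorem Matrix.IsHermitian.trace_pow_eq_sum_eigenvalues {n : ℕ} {A : Matrix (Fin n) (Fin n) ℂ}
    (hA : A.IsHermitian) (k : ℕ) :
    (A ^ k).trace = ∑ i, ((hA.eigenvalues i : ℂ)) ^ k := by
  conv_lhs => rw [hA.spectral_theorem]
  rw [← map_pow, Unitary.conjStarAlgAut_apply, Matrix.trace_mul_comm, ← mul_assoc]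
  simp [Matrix.diagonal_pow, Matrix.trace_diagonal]

theorem coe_esd {n : ℕ} (hn : n ≠ 0) {A : Matrix (Fin n) (Fin n) ℂ} (hA : A.IsHermitian) :
    (esd hA : Measure ℝ) = esdMeasure hA := by
  have h : esd hA = ⟨esdMeasure hA, isProbabilityMeasure_esdMeasure hn hA⟩ := dif_neg hn
  rw [h]
  rfl

theorem integrable_esd {n : ℕ} {A : Matrix (Fin n) (Fin n) ℂ} (hA : A.IsHermitian) (k : ℕ) :
    Integrable (fun x : ℝ => x ^ k) (esd hA : Measure ℝ) := by
  have hdirac : ∀ a : ℝ, Integrable (fun x : ℝ => x ^ k) (Measure.dirac a) := fun a =>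
    integrable_dirac (by simp)
  by_cases hn : n = 0
  · have h : esd hA = ⟨Measure.dirac 0, inferInstance⟩ := dif_pos hn
    rw [h]
    exact hdirac 0
  · rw [coe_esd hn]
    refine Integrable.smul_measure ?_ (ENNReal.inv_ne_top.2 (by exact_mod_cast hn))
    exact integrable_finsetSum_measure.2 fun i _ => hdirac _

theorem integral_pow_esd {n : ℕ} (hn : n ≠ 0) {A : Matrix (Fin n) (Fin n) ℂ}
    (hA : A.IsHermitian) (k : ℕ) :
    ((∫ x, x ^ k ∂(esd hA : Measure ℝ) : ℝ) : ℂ) = (n : ℂ)⁻¹ * (A ^ k).trace := by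
  rw [coe_esd hn, esdMeasure, integral_smul_measure, integral_finsetSum_measure
    fun i _ => integrable_dirac (by simp), hA.trace_pow_eq_sum_eigenvalues]
  simp

/-- The scale `n √n ^ k` of the trace of the `k`-th power. -/
noncomputable def traceScale (k n : ℕ) : ℝ := √(n : ℝ) ^ (k + 2)

theorem integral_pow_esd_normalized {n : ℕ} (hn : n ≠ 0) {A : Matrix (Fin n) (Fin n) ℂ}
    (hA : A.IsHermitian) (k : ℕ) :
    ((∫ x, x ^ k ∂(esd (normalized_isHermitian hA) : Measure ℝ) : ℝ) : ℂ) =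
      (A ^ k).trace / (traceScale k n : ℂ) := by
  rw [integral_pow_esd hn, normalized, smul_pow, Matrix.trace_smul, Complex.real_smul, traceScale,
    pow_add, Real.sq_sqrt (Nat.cast_nonneg n)]
  push_cast
  rw [div_pow, one_pow]
  field_simp

/-! ### Convergence of the expected moments -/

section Limits

variable {Ω : ℕ → Type*} [∀ n, MeasurableSpace (Ω n)] {P : ∀ n, Measure (Ω n)}
  {X : ∀ n, Ω n → Matrix (Fin n) (Fin n) ℂ}
  {r : ∀ n : ℕ, Setoid (Fin n × Fin n)}

theorem tendsto_inv_sqrt_natCast : Tendsto (fun n : ℕ => (√(n : ℝ))⁻¹) atTop (𝓝 0) :=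
  tendsto_inv_atTop_zero.comp (Real.tendsto_sqrt_atTop.comp tendsto_natCast_atTop_atTop)

/-- The scales multiply to `√n ^ (j + l + 4)`, one factor `√n` more than the bound on linked pairs.
-/
theorem tendsto_covariance_trace (hX : ∀ n, StandardEntries (P n) (X n) (r n)) {B : ℕ}
    (hr : ∀ n, RowBounded (r n) B)
    (hM : ∀ m, ∃ M, 0 ≤ M ∧ ∀ n, EntryProdBounded (P n) (X n) m M) (j l : ℕ) :
    Tendsto (fun n => (∫ ω, (X n ω ^ j).trace * (X n ω ^ l).trace ∂(P n)) /
          ((traceScale j n : ℂ) * traceScale l n) -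
        (∫ ω, (X n ω ^ j).trace ∂(P n)) / (traceScale j n : ℂ) *
          ((∫ ω, (X n ω ^ l).trace ∂(P n)) / (traceScale l n : ℂ))) atTop (𝓝 0) := by
  obtain ⟨M, hM0, hM⟩ := hM (j + l)
  set C : ℝ := Fintype.card ((Fin j ⊕ Fin l → Finset (Fin j ⊕ Fin l)) × Fin j × Fin l) *
    (B : ℝ) ^ (2 * (j + l + 2))
  refine squeeze_zero_norm' (a := fun n : ℕ => (M + M ^ 2) * C * (√(n : ℝ))⁻¹) ?_ ?_
  · filter_upwards [eventually_ge_atTop 1] with n hn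
    have hs : 0 < √(n : ℝ) := Real.sqrt_pos.2 (by exact_mod_cast hn)
    have h1 := (hX n).norm_covariance_trace_le j l (hM n)
    have h2 : ((linkedLoops (r n) j l).card : ℝ) ≤ C * √(n : ℝ) ^ (j + l + 3) :=
      card_linkedLoops_le (hr n)
    rw [div_mul_div_comm, ← sub_div, norm_div, ← Complex.ofReal_mul, Complex.norm_real,
      traceScale, traceScale, ← pow_add, Real.norm_of_nonneg (by positivity),
      div_le_iff₀ (by positivity)]
    calc _ ≤ (M + M ^ 2) * (C * √(n : ℝ) ^ (j + l + 3)) :=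
          h1.trans (mul_le_mul_of_nonneg_left h2 (by positivity))
      _ = _ := by
        rw [show j + 2 + (l + 2) = j + l + 3 + 1 by ring, pow_succ]
        field_simp
        ring
  · simpa using tendsto_inv_sqrt_natCast.const_mul ((M + M ^ 2) * C)

/-- All terms of the recursion share the scale of order `k + 2`. Relative to it, paths with few
classes contribute `O(1 / √n)` and badly paired ones `O((γ₁ + γ₃) / n ^ 2)`. -/
theorem tendsto_trace_recursion (hX : ∀ n, StandardEntries (P n) (X n) (r n)) {B : ℕ}
    (hr : ∀ n, RowBounded (r n) B) {γ₁ γ₃ : ℕ → ℕ} (h1 : ∀ n, StarBounded (r n) (γ₁ n))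
    (h3 : ∀ n, CherryBounded (r n) (γ₃ n))
    (hγ : Tendsto (fun n : ℕ => ((γ₁ n : ℝ) + γ₃ n) / (n : ℝ) ^ 2) atTop (𝓝 0))
    (hM : ∀ m, ∃ M, 0 ≤ M ∧ ∀ n, EntryProdBounded (P n) (X n) m M) (k : ℕ) :
    Tendsto (fun n => (∫ ω, (X n ω ^ (k + 2)).trace ∂(P n)) / (traceScale (k + 2) n : ℂ) -
      ∑ i : Fin (k + 1), (∫ ω, (X n ω ^ (i : ℕ)).trace * (X n ω ^ (k - i)).trace ∂(P n)) /
        ((traceScale i n : ℂ) * traceScale (k - i) n)) atTop (𝓝 0) := by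
  obtain ⟨M, hM0, hM⟩ := hM (k + 2)
  set C₁ : ℝ := Fintype.card (Fin (k + 2) → Finset (Fin (k + 2))) * (B : ℝ) ^ (k + 2 + 1)
  set C₂ : ℝ := Fintype.card ((Fin (k + 2) → Finset (Fin (k + 2))) ×
    Fin (k + 2) × Fin (k + 2) × Fin (k + 2)) * 2 * (B : ℝ) ^ (2 * (k + 2 + 1))
  refine squeeze_zero_norm' (a := fun n : ℕ => (k + 2) * M *
    (C₁ * (√(n : ℝ))⁻¹ + C₂ * (((γ₁ n : ℝ) + γ₃ n) / (n : ℝ) ^ 2))) ?_ ?_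
  · filter_upwards [eventually_ge_atTop 1] with n hn
    have hs : 0 < √(n : ℝ) := Real.sqrt_pos.2 (by exact_mod_cast hn)
    have hn' : (0 : ℝ) < n := by exact_mod_cast hn
    have hsq : √(n : ℝ) ^ 2 = n := Real.sq_sqrt hn'.le
    have hrec := (hX n).norm_integral_trace_pow_sub_le k (hM n)
    have hfew : ((fewClassPaths (r n) (k + 2)).card : ℝ) ≤ C₁ * √(n : ℝ) ^ (k + 2 + 1) :=
      card_fewClassPaths_le (hr n)
    have hbad : ((badPairedPaths (r n) (k + 2)).card : ℝ) * n ≤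
        C₂ * (γ₁ n + γ₃ n) * √(n : ℝ) ^ (k + 2) :=
      card_badPairedPaths_mul_le (hr n) (h1 n) (h3 n)
    have hscale : ∀ i : Fin (k + 1), (traceScale i n : ℂ) * traceScale (k - i) n =
        (traceScale (k + 2) n : ℂ) := by
      intro i
      rw [traceScale, traceScale, traceScale, ← Complex.ofReal_mul, ← pow_add,
        show (i : ℕ) + 2 + (k - i + 2) = k + 2 + 2 by omega]
    simp_rw [hscale]
    rw [← Finset.sum_div, ← sub_div, norm_div, Complex.norm_real, traceScale,
      Real.norm_of_nonneg (by positivity), div_le_iff₀ (by positivity)]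
    have hbad' : ((badPairedPaths (r n) (k + 2)).card : ℝ) ≤
        C₂ * (((γ₁ n : ℝ) + γ₃ n) / (n : ℝ) ^ 2) * √(n : ℝ) ^ (k + 2 + 2) := by
      rw [← le_div_iff₀ hn'] at hbad
      refine hbad.trans (le_of_eq ?_)
      rw [pow_add _ (k + 2) 2, hsq]
      field_simp
    calc _ ≤ (k + 2) * M * (C₁ * √(n : ℝ) ^ (k + 2 + 1) +
          C₂ * (((γ₁ n : ℝ) + γ₃ n) / (n : ℝ) ^ 2) * √(n : ℝ) ^ (k + 2 + 2)) :=
          hrec.trans (mul_le_mul_of_nonneg_left (add_le_add hfew hbad') (by positivity))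
      _ = _ := by
        rw [pow_succ _ (k + 2 + 1)]
        field_simp
  · simpa using ((tendsto_inv_sqrt_natCast.const_mul C₁).add (hγ.const_mul C₂)).const_mul
      ((k + 2) * M)

variable [∀ n, IsProbabilityMeasure (P n)]

/-- The trace recursion, with expectations of products replaced by products of expectations, becomes
the Catalan recursion in the limit. Order `1` is separate: its only step is a single class. -/
theorem tendsto_expected_moment (hX : ∀ n, StandardEntries (P n) (X n) (r n)) {B : ℕ}
    (hr : ∀ n, RowBounded (r n) B) {γ₁ γ₃ : ℕ → ℕ} (h1 : ∀ n, StarBounded (r n) (γ₁ n))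
    (h3 : ∀ n, CherryBounded (r n) (γ₃ n))
    (hγ : Tendsto (fun n : ℕ => ((γ₁ n : ℝ) + γ₃ n) / (n : ℝ) ^ 2) atTop (𝓝 0))
    (hM : ∀ m, ∃ M, 0 ≤ M ∧ ∀ n, EntryProdBounded (P n) (X n) m M) (k : ℕ) :
    Tendsto (fun n => (∫ ω, (X n ω ^ k).trace ∂(P n)) / (traceScale k n : ℂ)) atTop
      (𝓝 (semicircleMoment k : ℂ)) := by
  induction k using Nat.strong_induction_on with
  | _ k ih =>
  match k, ih with
  | 0, _ =>
    refine tendsto_const_nhds.congr' ?_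
    filter_upwards [eventually_ge_atTop 1] with n hn
    have hn' : (n : ℂ) ≠ 0 := by exact_mod_cast (by omega : n ≠ 0)
    simp [semicircleMoment, traceScale, Matrix.trace_one, hn']
  | 1, _ =>
    refine tendsto_const_nhds.congr fun n => ?_
    obtain ⟨M, -, hM⟩ := hM 1
    rw [StandardEntries.integral_trace_pow 1 (hM n), Finset.sum_eq_zero, zero_div,
      semicircleMoment_of_odd odd_one, Complex.ofReal_zero]
    intro p _
    by_contra hne
    obtain ⟨b, hb, -⟩ := (hX n).noSingleClass_of_integral_ne_zero hne 0
    exact hb (Subsingleton.elim _ _)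
  | k + 2, ih =>
    have hprod : ∀ i : Fin (k + 1), Tendsto (fun n =>
        (∫ ω, (X n ω ^ (i : ℕ)).trace * (X n ω ^ (k - i)).trace ∂(P n)) /
          ((traceScale i n : ℂ) * traceScale (k - i) n)) atTop
        (𝓝 ((semicircleMoment i : ℂ) * semicircleMoment (k - i))) := by
      intro i
      have := (tendsto_covariance_trace hX hr hM i (k - i)).add
        ((ih i (by omega)).mul (ih (k - i) (by omega)))
      simpa using this
    have := (tendsto_trace_recursion hX hr h1 h3 hγ hM k).add
      (tendsto_finsetSum Finset.univ fun i _ => hprod i)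
    rw [semicircleMoment_add_two]
    push_cast
    simpa using this

/-- The mean square deviation of the moments of the empirical spectral distribution from those of
the semicircle law tends to zero. -/
theorem tendsto_integral_sq_moment_sub (hX : ∀ n, StandardEntries (P n) (X n) (r n)) {B : ℕ}
    (hr : ∀ n, RowBounded (r n) B) {γ₁ γ₃ : ℕ → ℕ} (h1 : ∀ n, StarBounded (r n) (γ₁ n))
    (h3 : ∀ n, CherryBounded (r n) (γ₃ n))
    (hγ : Tendsto (fun n : ℕ => ((γ₁ n : ℝ) + γ₃ n) / (n : ℝ) ^ 2) atTop (𝓝 0))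
    (hM : ∀ m, ∃ M, 0 ≤ M ∧ ∀ n, EntryProdBounded (P n) (X n) m M) (k : ℕ) (m : ∀ n, Ω n → ℝ)
    (hm : ∀ n, n ≠ 0 → ∀ ω, (m n ω : ℂ) = (X n ω ^ k).trace / (traceScale k n : ℂ)) :
    Tendsto (fun n => ∫ ω, (m n ω - semicircleMoment k) ^ 2 ∂(P n)) atTop (𝓝 0) ∧
      ∀ n, n ≠ 0 → Integrable (fun ω => (m n ω - semicircleMoment k) ^ 2) (P n) := by
  set c : ℝ := semicircleMoment k with hc
  obtain ⟨M, -, hMk⟩ := hM (k + k)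
  have hint1 : ∀ n, Integrable (fun ω => (X n ω ^ k).trace) (P n) := by
    intro n
    simp_rw [trace_pow_eq_sum_entryProd]
    exact integrable_finsetSum _ fun p _ => (hMk n _ _ _ (by simp)).1
  have hint2 : ∀ n, Integrable (fun ω => (X n ω ^ k).trace * (X n ω ^ k).trace) (P n) := by
    intro n
    simp_rw [trace_pow_mul_trace_pow]
    exact integrable_finsetSum _ fun p _ => (hMk n _ _ _ (by simp)).1
  have hexp : ∀ n, n ≠ 0 → ∀ ω, (((m n ω - c) ^ 2 : ℝ) : ℂ) =
      (X n ω ^ k).trace * (X n ω ^ k).trace * ((traceScale k n : ℂ) * traceScale k n)⁻¹ -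
        (X n ω ^ k).trace * (2 * c * (traceScale k n : ℂ)⁻¹) + (c : ℂ) ^ 2 := by
    intro n hn ω
    push_cast
    rw [hm n hn ω, mul_inv]
    ring
  have hintc : ∀ n, n ≠ 0 → Integrable (fun ω => (((m n ω - c) ^ 2 : ℝ) : ℂ)) (P n) := by
    intro n hn
    simp_rw [hexp n hn]
    exact (((hint2 n).mul_const _).sub ((hint1 n).mul_const _)).add (integrable_const _)
  refine ⟨?_, fun n hn => by
    simpa only [RCLike.re_to_complex, Complex.ofReal_re] using (hintc n hn).re⟩
  have hlim1 := tendsto_expected_moment hX hr h1 h3 hγ hM k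
  have hlim2 : Tendsto (fun n => (∫ ω, (X n ω ^ k).trace * (X n ω ^ k).trace ∂(P n)) /
      ((traceScale k n : ℂ) * traceScale k n)) atTop (𝓝 ((c : ℂ) * c)) := by
    simpa using (tendsto_covariance_trace hX hr hM k k).add (hlim1.mul hlim1)
  have hlim : Tendsto (fun n => ((∫ ω, (m n ω - c) ^ 2 ∂(P n) : ℝ) : ℂ)) atTop (𝓝 0) := by
    -- The limits of the three terms in the expanded square.
    have h0 : (c : ℂ) * c - c * (2 * c) + (c : ℂ) ^ 2 = 0 := by ring
    rw [← h0]
    refine ((hlim2.sub (hlim1.mul_const (2 * (c : ℂ)))).add_const ((c : ℂ) ^ 2)).congr' ?_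
    filter_upwards [eventually_ge_atTop 1] with n hn
    rw [← integral_complex_ofReal]
    simp_rw [hexp n (by omega)]
    have hdiff : Integrable (fun ω => (X n ω ^ k).trace * (X n ω ^ k).trace *
        ((traceScale k n : ℂ) * traceScale k n)⁻¹ -
        (X n ω ^ k).trace * (2 * c * (traceScale k n : ℂ)⁻¹)) (P n) :=
      ((hint2 n).mul_const _).sub ((hint1 n).mul_const _)
    rw [integral_add hdiff (integrable_const _),
      integral_sub ((hint2 n).mul_const _) ((hint1 n).mul_const _), integral_mul_const,
      integral_mul_const, integral_const]
    simp only [probReal_univ, one_smul]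
    ring
  simpa only [Function.comp_def, Complex.ofReal_re, Complex.zero_re] using
    (Complex.continuous_re.tendsto 0).comp hlim

end Limits

/-! ### From mean square convergence of moments to weak convergence in probability -/

theorem mainTheorem5 {Ω : ℕ → Type*} [∀ n, MeasurableSpace (Ω n)]
    (P : ∀ n, Measure (Ω n)) [∀ n, IsProbabilityMeasure (P n)]
    (X : ∀ n, Ω n → Matrix (Fin n) (Fin n) ℂ)
    (r : ∀ n : ℕ, Setoid (Fin n × Fin n))
    (hmeas : ∀ n (i j : Fin n), Measurable fun ω => X n ω i j)
    (hherm : ∀ n ω, (X n ω).IsHermitian)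
    (hindep : ∀ n, IndependentClasses (P n) (X n) (r n))
    (hmean : ∀ n (i j : Fin n), ∫ ω, X n ω i j ∂(P n) = 0)
    (hvar : ∀ n (i j : Fin n), ∫ ω, ‖X n ω i j‖ ^ 2 ∂(P n) = 1)
    (hC0 : CondC0 P X) (hC1 : CondC1 r) (hC2 : CondC2 r) (hC3 : CondC3 r) :
    WeaklyConvergesInProbability P
      (fun n ω => esd (normalized_isHermitian (hherm n ω))) semicircleLaw := by
  have hX : ∀ n, StandardEntries (P n) (X n) (r n) := fun n =>
    ⟨hmeas n, hherm n, hindep n, hmean n, hvar n⟩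
  have hM : ∀ m, ∃ M, 0 ≤ M ∧ ∀ n, EntryProdBounded (P n) (X n) m M := by
    intro m
    obtain ⟨M, hM0, hM⟩ := hC0.exists_bound_entryProd hmeas m
    exact ⟨M, hM0, fun n => hM n⟩
  obtain ⟨B, hB0, hB⟩ := hC2
  have hr : ∀ n, RowBounded (r n) ⌈B⌉₊ := by
    refine fun n => ⟨Nat.one_le_ceil_iff.2 hB0, fun i j => (hX n).indep.rel_swap (hX n).meas
      (hX n).mean (hX n).herm (hX n).var i j, fun i j i' => ?_⟩
    have := hB n i j i'
    rw [Set.ncard_eq_toFinset_card _ (Set.toFinite _)] at this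
    exact_mod_cast this.trans (Nat.le_ceil B)
  set γ₁ : ℕ → ℕ := fun n => Finset.univ.sup fun i : Fin n =>
    {t : Fin n × Fin n × Fin n | (r n) (i, t.1) (t.2.1, t.2.2)}.ncard with hγ₁
  set γ₃ : ℕ → ℕ := fun n => {t : Fin n × Fin n × Fin n |
    (r n) (t.1, t.2.1) (t.2.1, t.2.2) ∧ t.2.2 ≠ t.1}.ncard with hγ₃
  have h1 : ∀ n, StarBounded (r n) (γ₁ n) := by
    intro n i
    rw [← Set.ncard_eq_toFinset_card _ (Set.toFinite _)]
    exact Finset.le_sup (f := fun i : Fin n =>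
      {t : Fin n × Fin n × Fin n | (r n) (i, t.1) (t.2.1, t.2.2)}.ncard) (Finset.mem_univ i)
  have h3 : ∀ n, CherryBounded (r n) (γ₃ n) := by
    intro n
    rw [CherryBounded, ← Set.ncard_eq_toFinset_card _ (Set.toFinite _)]
  have hγ : Tendsto (fun n : ℕ => ((γ₁ n : ℝ) + γ₃ n) / (n : ℝ) ^ 2) atTop (𝓝 0) := by
    have e1 : Tendsto (fun n : ℕ => (γ₁ n : ℝ) / (n : ℝ) ^ 2) atTop (𝓝 0) :=
      hC1.tendsto_div_nhds_zero
    have e3 : Tendsto (fun n : ℕ => (γ₃ n : ℝ) / (n : ℝ) ^ 2) atTop (𝓝 0) :=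
      hC3.tendsto_div_nhds_zero
    simpa [add_div] using e1.add e3
  intro d hd ε hε
  obtain ⟨K, δ, hδ, hnear⟩ := hd.exists_moments_near hε
  let m : ℕ → ∀ n, Ω n → ℝ := fun k n ω =>
    ∫ x, x ^ k ∂(esd (normalized_isHermitian (hherm n ω)) : Measure ℝ)
  -- Chebyshev's inequality for each moment.
  have hmoment : ∀ k, Tendsto (fun n => (P n) {ω | δ ^ 2 ≤ (m k n ω - semicircleMoment k) ^ 2})
      atTop (𝓝 0) := by
    intro k
    obtain ⟨hlim, hint⟩ := tendsto_integral_sq_moment_sub hX hr h1 h3 hγ hM k (m k)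
      (fun n hn ω => integral_pow_esd_normalized hn (hherm n ω) k)
    have hbound : Tendsto (fun n => ENNReal.ofReal
        ((∫ ω, (m k n ω - semicircleMoment k) ^ 2 ∂(P n)) / δ ^ 2)) atTop (𝓝 0) := by
      simpa using ENNReal.tendsto_ofReal (hlim.div_const (δ ^ 2))
    refine tendsto_of_tendsto_of_tendsto_of_le_of_le' tendsto_const_nhds hbound
      (Eventually.of_forall fun _ => zero_le) ?_
    filter_upwards [eventually_ge_atTop 1] with n hn
    rw [← ofReal_measureReal]
    refine ENNReal.ofReal_le_ofReal ?_
    rw [le_div_iff₀ (by positivity), mul_comm]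
    exact mul_meas_ge_le_integral_of_nonneg (Eventually.of_forall fun _ => sq_nonneg _)
      (hint n (by omega)) _
  have hsum : Tendsto (fun n => ∑ k ∈ Finset.range K,
      (P n) {ω | δ ^ 2 ≤ (m k n ω - semicircleMoment k) ^ 2}) atTop (𝓝 0) := by
    simpa using tendsto_finsetSum (Finset.range K) fun k _ => hmoment k
  refine tendsto_of_tendsto_of_tendsto_of_le_of_le tendsto_const_nhds hsum
    (fun _ => zero_le) fun n => ?_
  -- A union bound: if `d` exceeds `ε`, one of the first `K` moments is off by at least `δ`.
  refine (measure_mono ?_).trans (measure_biUnion_finset_le _ _)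
  intro ω hω
  by_contra hcon
  refine absurd (hnear (esd (normalized_isHermitian (hherm n ω))) (integrable_esd _) ?_)
    (not_le.2 hω)
  intro k hk
  simp only [Set.mem_iUnion, not_exists] at hcon
  exact abs_lt_of_sq_lt_sq (not_le.1 (hcon k (Finset.mem_range.2 hk))) hδ.le
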